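/- Let $n\ge 1$, and consider the nodes $(i,j)$, $1\le i,j\le n$, of the $n\times n$ square grid. \emph{The 20V model.} Take all horizontal edges between $(i,j)$ and $(i+1,j)$, all vertical edges between $(i,j)$ and $(i,j+1)$ and all diagonal edges between $(i,j+1)$ and $(i+1,j)$ that have at least one endpoint among the nodes; those with exactly one endpoint among the nodes are the boundary edges. A 20V configuration is an orientation of all these edges such that each node has exactly three incoming and three outgoing edges. It has domain wall boundary conditions of type 1 (DWBC1), respectively type 2 (DWBC2), if its boundary edges are oriented as follows: \begin{itemize} \item West: $(0,j)\to(1,j)$ for $1\le j\le n$, and $(0,j+1)\to(1,j)$ for $1\le j\le n-1$; \item South: $(i,1)\to(i,0)$ for $1\le i\le n$, and $(i,1)\to(i+1,0)$ for $1\le i\le n-1$; \item East: $(n+1,j)\to(n,j)$ for $1\le j\le n$, and $(n+1,j)\to(n,j+1)$ for $1\le j\le n-1$; \item North: $(i,n)\to(i,n+1)$ for $1\le i\le n$, and $(i+1,n)\to(i,n+1)$ for $1\le i\le n-1$; \item corners: $(0,n+1)\to(1,n)$ and $(n,1)\to(n+1,0)$ for DWBC1, respectively $(1,n)\to(0,n+1)$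 and $(n+1,0)\to(n,1)$ for DWBC2. \end{itemize} \emph{The 6V model.} Take only the horizontal and vertical edges above. A 6V configuration with DWBC is an orientation of them such that each node has exactly two incoming and two outgoing edges, all horizontal boundary edges point towards the grid and all vertical boundary edges point away from it. Call an edge \emph{covered} if it is oriented from West to East or from North to South. A node has weight $a$ if all or none of its four edges are covered, weight $b$ if its covered edges are exactly its two horizontal edges or exactly its two vertical edges, and weight $c$ if its covered edges are exactly the West and South edges or exactly the North and East edges. The partition function $Z^{6V}_{[a,b,c]}(n)$ is the sum over all 6V configurations with DWBC of the product of the weights of the $n^2$ nodes. \textbf{Theorem.} For every $n\ge 1$, the number of 20V configurations with DWBC1 and the number of 20V configurations with DWBC2 are both equal to $$A_n = Z^{6V}_{[1,\sqrt2,1]}(n).$$ -/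

import Mathlib

/-!  Ice models on an `n × n` grid.

The nodes of the grid are the points `(x, y)` with `1 ≤ x, y ≤ n`.  The node `(x, y)` is
represented by `(i, j) : Fin n × Fin n` with `x = i + 1` and `y = j + 1`; the first coordinate
grows to the East and the second one to the North.

An orientation of an edge is a Boolean: `true` if the edge points in its natural direction and
`false` if it points in the opposite direction.  The natural directions are West to East for
horizontal edges, North to South for vertical edges and Northwest to Southeast for diagonal
edges. -/

namespace IceModel

/-- The diagonal edges of the `n × n` grid, inner and boundary ones.  The pair `(i, j)` with
`0 ≤ i, j ≤ n` stands for the segment between `(i, j + 1)` and `(i + 1, j)`.  The pairs `(0, 0)`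
and `(n, n)` are left out: these two segments touch no node of the grid. -/
abbrev DiagEdge (n : ℕ) : Type :=
  {p : Fin (n + 1) × Fin (n + 1) // p ≠ (0, 0) ∧ p ≠ (Fin.last n, Fin.last n)}

/-- The diagonal edge that joins the node `(i, j)` to its Northwest neighbour. -/
def nwEdge {n : ℕ} (i j : Fin n) : DiagEdge n :=
  ⟨(i.castSucc, j.succ),
    fun h => Fin.succ_ne_zero j (Prod.mk.inj h).2,
    fun h => (Fin.castSucc_lt_last i).ne (Prod.mk.inj h).1⟩

/-- The diagonal edge that joins the node `(i, j)` to its Southeast neighbour. -/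
def seEdge {n : ℕ} (i j : Fin n) : DiagEdge n :=
  ⟨(i.succ, j.castSucc),
    fun h => Fin.succ_ne_zero i (Prod.mk.inj h).1,
    fun h => (Fin.castSucc_lt_last j).ne (Prod.mk.inj h).2⟩

/-- An orientation of all the edges (inner and boundary) of the `n × n` square grid.
* `hor i j` is the orientation of the horizontal edge between `(i, j + 1)` and `(i + 1, j + 1)`;
* `ver i j` is the orientation of the vertical edge between `(i + 1, j + 1)` and `(i + 1, j)`. -/
@[ext]
structure SquareOrientation (n : ℕ) where
  hor : Fin (n + 1) → Fin n → Bool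
  ver : Fin n → Fin (n + 1) → Bool

instance (n : ℕ) : Fintype (SquareOrientation n) :=
  Fintype.ofEquiv ((Fin (n + 1) → Fin n → Bool) × (Fin n → Fin (n + 1) → Bool))
    { toFun := fun p => ⟨p.1, p.2⟩
      invFun := fun σ => (σ.hor, σ.ver)
      left_inv := fun _ => rfl
      right_inv := fun _ => rfl }

/-- An orientation of all the edges (inner and boundary) of the `n × n` portion of the triangular
lattice, which is the square grid with the second diagonal of each face added. -/
@[ext]
structure TriOrientation (n : ℕ) extends SquareOrientation n where
  diag : DiagEdge n → Bool

instance (n : ℕ) : Fintype (TriOrientation n) :=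
  Fintype.ofEquiv (SquareOrientation n × (DiagEdge n → Bool))
    { toFun := fun p => ⟨p.1, p.2⟩
      invFun := fun σ => (σ.toSquareOrientation, σ.diag)
      left_inv := fun _ => rfl
      right_inv := fun _ => rfl }

namespace SquareOrientation

variable {n : ℕ} (σ : SquareOrientation n) (i j : Fin n)

/-- Orientation of the edge to the West of the node `(i, j)`. -/
def west : Bool := σ.hor i.castSucc j

/-- Orientation of the edge to the East of the node `(i, j)`. -/
def east : Bool := σ.hor i.succ j

/-- Orientation of the edge to the North of the node `(i, j)`. -/
def north : Bool := σ.ver i j.succ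

/-- Orientation of the edge to the South of the node `(i, j)`. -/
def south : Bool := σ.ver i j.castSucc

/-- Number of arrows among the four edges at the node `(i, j)` that point to the node.
The natural direction points to the node on the West and North edges only. -/
def incoming : ℕ :=
  (σ.west i j).toNat + (σ.north i j).toNat + (!σ.east i j).toNat + (!σ.south i j).toNat

/-- Number of arrows among the four edges at the node `(i, j)` that point away from it. -/
def outgoing : ℕ :=
  (!σ.west i j).toNat + (!σ.north i j).toNat + (σ.east i j).toNat + (σ.south i j).toNat

/-- The ice rule: two incoming and two outgoing edges at each node. -/
def IceRule : Prop := ∀ i j : Fin n, σ.incoming i j = 2 ∧ σ.outgoing i j = 2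

/-- Domain wall boundary conditions: the horizontal boundary edges point to the grid and the
vertical ones point away from it. -/
def DWBC : Prop :=
  (∀ j, σ.hor 0 j = true) ∧ (∀ j, σ.hor (Fin.last n) j = false) ∧
    (∀ i, σ.ver i 0 = true) ∧ (∀ i, σ.ver i (Fin.last n) = false)

instance : Decidable σ.IceRule := by unfold IceRule; infer_instance

instance : Decidable σ.DWBC := by unfold DWBC; infer_instance

end SquareOrientation

/-- The weight of a vertex of the 6V model, as a function of the orientations of its West, North,
East and South edges.  In terms of osculating paths, which cover the edges that carry the value
`true`: weight `a` if the node is visited by no path or by two paths, `b` if one path goes straight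
through the node, `c` if one path turns at the node. -/
def sixVertexWeight {R : Type*} [Zero R] (a b c : R) : Bool → Bool → Bool → Bool → R
  | true, true, true, true => a
  | false, false, false, false => a
  | true, false, true, false => b
  | false, true, false, true => b
  | true, false, false, true => c
  | false, true, true, false => c
  | _, _, _, _ => 0

/-- The partition function of the 6V model on the `n × n` grid with domain wall boundary
conditions and weights `(a, b, c)`. -/
def Z6V {R : Type*} [CommSemiring R] (n : ℕ) (a b c : R) : R :=
  ∑ σ : SquareOrientation n with σ.IceRule ∧ σ.DWBC,
    ∏ i : Fin n, ∏ j : Fin n,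
      sixVertexWeight a b c (σ.west i j) (σ.north i j) (σ.east i j) (σ.south i j)

namespace TriOrientation

variable {n : ℕ} (σ : TriOrientation n)

/-- Orientation of the edge to the Northwest of the node `(i, j)`. -/
def northwest (i j : Fin n) : Bool := σ.diag (nwEdge i j)

/-- Orientation of the edge to the Southeast of the node `(i, j)`. -/
def southeast (i j : Fin n) : Bool := σ.diag (seEdge i j)

/-- The triangular ice rule: three incoming and three outgoing edges at each node. -/
def IceRule : Prop :=
  ∀ i j : Fin n,
    σ.toSquareOrientation.incoming i j
        + (σ.northwest i j).toNat + (!σ.southeast i j).toNat = 3 ∧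
      σ.toSquareOrientation.outgoing i j
        + (!σ.northwest i j).toNat + (σ.southeast i j).toNat = 3

/-- The boundary conditions common to DWBC1 and DWBC2.  The horizontal boundary edges point to the
grid and the vertical ones away from it.  The diagonal edges of the West boundary
(`(0, y + 1)` to `(1, y)`, `1 ≤ y ≤ n - 1`) and of the South boundary (`(x, 1)` to `(x + 1, 0)`,
`1 ≤ x ≤ n - 1`) have the natural orientation, those of the East boundary (`(n + 1, y)` to
`(n, y + 1)`, `1 ≤ y ≤ n - 1`) and of the North boundary (`(x + 1, n)` to `(x, n + 1)`,
`1 ≤ x ≤ n - 1`) the opposite one.  Nothing is said on the two corner edges `(0, n)` and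
`(n, 0)`. -/
def BoundaryRule : Prop :=
  σ.toSquareOrientation.DWBC ∧
    ∀ e : DiagEdge n,
      (e.1.1 = 0 → e.1.2 ≠ Fin.last n → σ.diag e = true) ∧
      (e.1.2 = 0 → e.1.1 ≠ Fin.last n → σ.diag e = true) ∧
      (e.1.1 = Fin.last n → e.1.2 ≠ 0 → σ.diag e = false) ∧
      (e.1.2 = Fin.last n → e.1.1 ≠ 0 → σ.diag e = false)

/-- The two corner diagonal edges, `(0, n + 1)` to `(1, n)` and `(n, 1)` to `(n + 1, 0)`, both
carry the orientation `o`. -/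
def CornerRule (o : Bool) : Prop :=
  ∀ e : DiagEdge n,
    (e.1 = (0, Fin.last n) → σ.diag e = o) ∧ (e.1 = (Fin.last n, 0) → σ.diag e = o)

/-- DWBC1: the corner edges point from `(0, n + 1)` to `(1, n)` and from `(n, 1)` to
`(n + 1, 0)`. -/
def DWBC1 : Prop := σ.BoundaryRule ∧ σ.CornerRule true

/-- DWBC2: the corner edges point from `(1, n)` to `(0, n + 1)` and from `(n + 1, 0)` to
`(n, 1)`. -/
def DWBC2 : Prop := σ.BoundaryRule ∧ σ.CornerRule false

instance : Decidable σ.IceRule := by unfold IceRule; infer_instance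

instance : Decidable σ.BoundaryRule := by unfold BoundaryRule; infer_instance

instance (o : Bool) : Decidable (σ.CornerRule o) := by unfold CornerRule; infer_instance

instance : Decidable σ.DWBC1 := by unfold DWBC1; infer_instance

instance : Decidable σ.DWBC2 := by unfold DWBC2; infer_instance

end TriOrientation

/-- The number of 20V configurations with DWBC1 on the `n × n` grid. -/
def count20V1 (n : ℕ) : ℕ :=
  Fintype.card {σ : TriOrientation n // σ.IceRule ∧ σ.DWBC1}

/-- The number of 20V configurations with DWBC2 on the `n × n` grid. -/
def count20V2 (n : ℕ) : ℕ :=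
  Fintype.card {σ : TriOrientation n // σ.IceRule ∧ σ.DWBC2}

end IceModel

/-! Resolve each node of the triangular lattice into three pairwise crossings by shifting its
diagonal slightly off the node. Let the crossings of a diagonal have 6V weights (√2, 1, 1) and those
of a horizontal with a vertical line (1, √2, 1). Summing over the inner edges of the small triangle
gives 2 for every outcome allowed by the triangular ice rule, on whichever side the diagonal passes
(`op3_wM_eq_down`, `op3_wM_eq_up`). The two resolutions therefore agree, which is the Yang–Baxter
equation `yangBaxter`: diagonals can slide freely across the grid.

Number the diagonals by k = i + j from the Southwest. Both boundary conditions say that, at its two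
ends, a diagonal is covered exactly when k < t, with t = n for DWBC1 and t = n - 1 for DWBC2. Slide
the covered diagonals out to the Southwest, where they meet only covered ends of horizontal and
vertical lines, and the others out to the Northeast, where they meet only uncovered ends. All these
outer crossings are frozen with weight √2. A diagonal with l nodes meets 2l of them and contributes
2^l, so the total is 2^(n²), and the 6V model with weights (1, √2, 1) is left on the grid
(`elt_topRows_eq`). The same factor 2^(n²) comes from fusing the n² triangles into 20V nodes, and it
cancels.

Crossings are encoded as operators on functions of line states, so that sliding is algebra in a
monoid. The partition functions are matrix elements, turned back into sums over orientations by
`elt_grid3_eq_sum`. -/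

namespace IceModel

open Function

/-! ### Crossings as linear operators -/

/-- The lines of the triangular lattice: horizontal, diagonal and vertical ones. -/
inductive Line : Type
  | h (j : ℕ)
  | d (k : ℕ)
  | v (i : ℕ)
  deriving DecidableEq

/-- Linear operators on the functions of the states of all the lines. -/
abbrev LineOp : Type := Module.End ℝ ((Line → Bool) → ℝ)

/-- The crossing of the lines `a` and `b` with Boltzmann weights `w`. -/
def op2 (w : Bool → Bool → Bool → Bool → ℝ) (a b : Line) : LineOp where
  -- `σ` is the state before the crossing and `F` is evaluated after it, so in a product the left
  -- factor is the crossing met first.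
  toFun F σ := ∑ x, ∑ y, w (σ a) (σ b) x y * F (update (update σ a x) b y)
  map_add' F G := by
    ext σ
    simp only [Pi.add_apply, mul_add, Finset.sum_add_distrib]
  map_smul' r F := by
    ext σ
    simp only [Pi.smul_apply, smul_eq_mul, Finset.mul_sum, RingHom.id_apply]
    exact Finset.sum_congr rfl fun x _ => Finset.sum_congr rfl fun y _ => by ring

theorem op2_apply (w : Bool → Bool → Bool → Bool → ℝ) (a b : Line) (F : (Line → Bool) → ℝ)
    (σ : Line → Bool) :
    op2 w a b F σ = ∑ x, ∑ y, w (σ a) (σ b) x y * F (update (update σ a x) b y) := rfl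

/-- The triple crossing of the lines `a`, `b` and `c` with Boltzmann weights `w`. -/
def op3 (w : Bool → Bool → Bool → Bool → Bool → Bool → ℝ) (a b c : Line) : LineOp where
  toFun F σ := ∑ x, ∑ y, ∑ z,
    w (σ a) (σ b) (σ c) x y z * F (update (update (update σ a x) b y) c z)
  map_add' F G := by
    ext σ
    simp only [Pi.add_apply, mul_add, Finset.sum_add_distrib]
  map_smul' r F := by
    ext σ
    simp only [Pi.smul_apply, smul_eq_mul, Finset.mul_sum, RingHom.id_apply]
    exact Finset.sum_congr rfl fun x _ => Finset.sum_congr rfl fun y _ =>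
      Finset.sum_congr rfl fun z _ => by ring

theorem op3_apply (w : Bool → Bool → Bool → Bool → Bool → Bool → ℝ) (a b c : Line)
    (F : (Line → Bool) → ℝ) (σ : Line → Bool) :
    op3 w a b c F σ = ∑ x, ∑ y, ∑ z,
      w (σ a) (σ b) (σ c) x y z * F (update (update (update σ a x) b y) c z) := rfl

/-- Crossings of disjoint pairs of lines commute. -/
theorem op2_commute (w w' : Bool → Bool → Bool → Bool → ℝ) {a b c d : Line}
    (hac : a ≠ c) (had : a ≠ d) (hbc : b ≠ c) (hbd : b ≠ d) :
    Commute (op2 w a b) (op2 w' c d) := by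
  ext F σ
  simp only [Module.End.mul_apply, op2_apply, Finset.mul_sum, update_of_ne hac, update_of_ne had,
    update_of_ne hbc, update_of_ne hbd, update_of_ne hac.symm, update_of_ne had.symm,
    update_of_ne hbc.symm, update_of_ne hbd.symm]
  have comm4 : ∀ f : Bool → Bool → Bool → Bool → ℝ,
      ∑ x, ∑ y, ∑ z, ∑ t, f x y z t = ∑ z, ∑ t, ∑ x, ∑ y, f x y z t := by
    intro f
    simp only [Fintype.sum_bool]
    ring
  rw [comm4]
  refine Finset.sum_congr rfl fun z _ => Finset.sum_congr rfl fun t _ =>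
    Finset.sum_congr rfl fun x _ => Finset.sum_congr rfl fun y _ => ?_
  rw [update_comm hbc, update_comm hac, update_comm hbd, update_comm had]
  ring

/-- The weights of the crossing of a horizontal and a vertical line. -/
noncomputable def wB : Bool → Bool → Bool → Bool → ℝ := fun p q p' q' =>
  if p = q then (if p' = p ∧ q' = p then 1 else 0)
  else if p' = p ∧ q' = q then √2 else if p' = q ∧ q' = p then 1 else 0

/-- The weights of the crossing of a diagonal line with a horizontal or a vertical one. -/
noncomputable def wA : Bool → Bool → Bool → Bool → ℝ := fun p q p' q' =>
  if p = q then (if p' = p ∧ q' = p then √2 else 0)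
  else if p' = p ∧ q' = q then 1 else if p' = q ∧ q' = p then 1 else 0

/-- The uniform weights of the 20V model. -/
def wM : Bool → Bool → Bool → Bool → Bool → Bool → ℝ := fun p q r p' q' r' =>
  if p.toNat + q.toNat + r.toNat = p'.toNat + q'.toNat + r'.toNat then 1 else 0

theorem wA_self (p : Bool) (x y : Bool) : wA p p x y = if x = p ∧ y = p then √2 else 0 := by
  simp [wA]

/-- A crossing of a diagonal line acts as a scalar on the states where both lines agree. -/
theorem op2_wA_apply_of_eq {a b : Line} (F : (Line → Bool) → ℝ) {σ : Line → Bool}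
    (h : σ a = σ b) : op2 wA a b F σ = √2 * F σ := by
  have e : update (update σ a (σ a)) b (σ a) = σ := by rw [update_eq_self, h, update_eq_self]
  rw [op2_apply, ← h, Finset.sum_eq_single (σ a), Finset.sum_eq_single (σ a), e, wA_self]
  · simp
  · intro y _ hy
    simp [wA_self, hy]
  · simp
  · intro x _ hx
    simp [wA_self, hx]
  · simp

/-- The indicator function of a state. -/
noncomputable def ind (τ : Line → Bool) : (Line → Bool) → ℝ := by
  classical exact fun σ => if σ = τ then 1 else 0

theorem ind_of_ne {σ τ : Line → Bool} (h : σ ≠ τ) : ind τ σ = 0 := if_neg h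

/-- A crossing of a diagonal line acts as a scalar on the indicator function of a state where both
lines agree. -/
theorem op2_wA_indicator {a b : Line} (hab : a ≠ b) {τ : Line → Bool} (h : τ a = τ b) :
    op2 wA a b (ind τ) = √2 • ind τ := by
  ext σ
  by_cases hs : σ a = σ b
  · rw [op2_wA_apply_of_eq _ hs]
    rfl
  · have hne : σ ≠ τ := fun e => hs (by rw [e, h])
    rw [op2_apply, Pi.smul_apply, ind_of_ne hne, smul_zero]
    refine Finset.sum_eq_zero fun x _ => Finset.sum_eq_zero fun y _ => ?_
    by_cases hxy : x = y
    -- Different inputs with equal outputs would change the number of covered lines.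
    · have : wA (σ a) (σ b) x y = 0 := by
        subst hxy
        unfold wA
        cases x <;> revert hs <;> cases σ a <;> cases σ b <;> simp
      rw [this, zero_mul]
    · rw [ind_of_ne, mul_zero]
      intro e
      apply hxy
      have e1 := congrFun e a
      have e2 := congrFun e b
      rw [update_of_ne hab, update_self] at e1
      rw [update_self] at e2
      rw [e1, e2, h]

/-! ### Resolving a 20V node into three crossings -/

theorem sqrt_two_mul_self : √(2 : ℝ) * √2 = 2 := by norm_num

/-- Each allowed outcome comes either from one inner state of weight √2 · √2 or from two inner
states of weight 1. -/
theorem triangle_down (g : Bool → Bool → Bool → ℝ) (p q r : Bool) :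
    ∑ x₁, ∑ y₁, wA p q x₁ y₁ * ∑ x₂, ∑ z₁, wB x₁ r x₂ z₁ *
      ∑ y₂, ∑ z₂, wA y₁ z₁ y₂ z₂ * g x₂ y₂ z₂ =
    2 * ∑ x, ∑ y, ∑ z, wM p q r x y z * g x y z := by
  have h := sqrt_two_mul_self
  cases p <;> cases q <;> cases r <;> simp [wA, wB, wM] <;> grind

theorem triangle_up (g : Bool → Bool → Bool → ℝ) (p q r : Bool) :
    ∑ y₁, ∑ z₁, wA q r y₁ z₁ * ∑ x₁, ∑ z₂, wB p z₁ x₁ z₂ *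
      ∑ x₂, ∑ y₂, wA x₁ y₁ x₂ y₂ * g x₂ y₂ z₂ =
    2 * ∑ x, ∑ y, ∑ z, wM p q r x y z * g x y z := by
  have h := sqrt_two_mul_self
  cases p <;> cases q <;> cases r <;> simp [wA, wB, wM] <;> grind

/-- With `a`, `b`, `c` horizontal, diagonal and vertical, the diagonal passes Southwest of the
crossing of `a` and `c`. In `op3_wM_eq_up` it passes Northeast. -/
theorem op3_wM_eq_down {a b c : Line} (hab : a ≠ b) (hac : a ≠ c) (hbc : b ≠ c) :
    op2 wA a b * op2 wB a c * op2 wA b c = (2 : ℝ) • op3 wM a b c := by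
  ext F σ
  have key := triangle_down (fun x y z => F (update (update (update σ a x) b y) c z))
    (σ a) (σ b) (σ c)
  simp only [LinearMap.smul_apply, Pi.smul_apply, smul_eq_mul, op3_apply, ← key,
    Module.End.mul_apply, op2_apply, update_self, update_of_ne hab,
    update_of_ne hbc, update_of_ne hab.symm, update_of_ne hac.symm, update_of_ne hbc.symm]
  refine Finset.sum_congr rfl fun x _ => Finset.sum_congr rfl fun y _ => ?_
  congr 1
  refine Finset.sum_congr rfl fun x' _ => Finset.sum_congr rfl fun z _ => ?_
  congr 1
  refine Finset.sum_congr rfl fun y' _ => Finset.sum_congr rfl fun z' _ => ?_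
  congr 2
  ext l
  simp only [update_apply]
  split_ifs <;> rfl

theorem op3_wM_eq_up {a b c : Line} (hab : a ≠ b) (hac : a ≠ c) (hbc : b ≠ c) :
    op2 wA b c * op2 wB a c * op2 wA a b = (2 : ℝ) • op3 wM a b c := by
  ext F σ
  have key := triangle_up (fun x y z => F (update (update (update σ a x) b y) c z))
    (σ a) (σ b) (σ c)
  simp only [LinearMap.smul_apply, Pi.smul_apply, smul_eq_mul, op3_apply, ← key,
    Module.End.mul_apply, op2_apply, update_self, update_of_ne hab, update_of_ne hac,
    update_of_ne hbc, update_of_ne hab.symm]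
  refine Finset.sum_congr rfl fun x _ => Finset.sum_congr rfl fun y _ => ?_
  congr 1
  refine Finset.sum_congr rfl fun x' _ => Finset.sum_congr rfl fun z _ => ?_
  congr 1
  refine Finset.sum_congr rfl fun y' _ => Finset.sum_congr rfl fun z' _ => ?_
  congr 2
  ext l
  simp only [update_apply]
  split_ifs <;> simp_all

/-! ### Ordered products in a monoid -/

section SegProd

variable {M : Type*} [Monoid M]

/-- The product `f a * f (a + 1) * ⋯ * f (a + l - 1)`. -/
def segProd (f : ℕ → M) (a l : ℕ) : M := ((List.range' a l).map f).prod

@[simp]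
theorem segProd_zero (f : ℕ → M) (a : ℕ) : segProd f a 0 = 1 := rfl

theorem segProd_succ (f : ℕ → M) (a l : ℕ) : segProd f a (l + 1) = segProd f a l * f (a + l) := by
  simp [segProd, List.range'_1_concat]

theorem segProd_succ' (f : ℕ → M) (a l : ℕ) :
    segProd f a (l + 1) = f a * segProd f (a + 1) l := by
  simp [segProd, List.range'_succ]

theorem segProd_add (f : ℕ → M) (a l l' : ℕ) :
    segProd f a (l + l') = segProd f a l * segProd f (a + l) l' := by
  simp [segProd, ← List.range'_append_1]

theorem segProd_congr {f g : ℕ → M} {a l : ℕ} (h : ∀ i, a ≤ i → i < a + l → f i = g i) :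
    segProd f a l = segProd g a l := by
  unfold segProd
  congr 1
  refine List.map_congr_left fun i hi => ?_
  rw [List.mem_range'_1] at hi
  exact h i hi.1 hi.2

theorem commute_segProd {x : M} {f : ℕ → M} {a l : ℕ}
    (h : ∀ i, a ≤ i → i < a + l → Commute x (f i)) : Commute x (segProd f a l) := by
  induction l with
  | zero => exact Commute.one_right x
  | succ l ih =>
    rw [segProd_succ]
    exact (ih fun i h1 h2 => h i h1 (by omega)).mul_right (h _ (by omega) (by omega))

theorem segProd_commute_segProd {f g : ℕ → M} {a l a' l' : ℕ}
    (h : ∀ i, a ≤ i → i < a + l → ∀ i', a' ≤ i' → i' < a' + l' → Commute (f i) (g i')) :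
    Commute (segProd f a l) (segProd g a' l') :=
  commute_segProd fun i' h1 h2 => (commute_segProd fun i h3 h4 => (h i h3 h4 i' h1 h2).symm).symm

/-- A product of `n` factors is split at the factor of index `m`. -/
theorem segProd_split (f : ℕ → M) {m n : ℕ} (h : m < n) :
    segProd f 0 n = segProd f 0 m * (f m * segProd f (m + 1) (n - (m + 1))) := by
  obtain ⟨l, rfl⟩ : ∃ l, n = m + (l + 1) := ⟨n - m - 1, by omega⟩
  rw [segProd_add, segProd_succ', zero_add]
  congr 4
  omega

end SegProd

/-! ### Yang–Baxter equation and grids with some of the diagonals -/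

open Line

/-- The crossing of the horizontal line `j` and the diagonal line `k`. -/
noncomputable def crossHD (j k : ℕ) : LineOp := op2 wA (h j) (d k)

/-- The crossing of the horizontal line `j` and the vertical line `i`. -/
noncomputable def crossHV (j i : ℕ) : LineOp := op2 wB (h j) (v i)

/-- The crossing of the diagonal line `k` and the vertical line `i`. -/
noncomputable def crossDV (k i : ℕ) : LineOp := op2 wA (d k) (v i)

/-- Both sides are twice the uniform triple crossing. -/
theorem yangBaxter (j k i : ℕ) :
    crossDV k i * crossHV j i * crossHD j k = crossHD j k * crossHV j i * crossDV k i := by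
  unfold crossDV crossHV crossHD
  rw [op3_wM_eq_up, op3_wM_eq_down] <;> simp

theorem commute_crossHD_crossHD {j j' k k' : ℕ} (hj : j ≠ j') (hk : k ≠ k') :
    Commute (crossHD j k) (crossHD j' k') := by
  apply op2_commute <;> simp [hj, hk]

theorem commute_crossHD_crossHV {j j' : ℕ} (hj : j ≠ j') (k i : ℕ) :
    Commute (crossHD j k) (crossHV j' i) := by
  apply op2_commute <;> simp [hj]

theorem commute_crossHD_crossDV {k k' : ℕ} (hk : k ≠ k') (j i : ℕ) :
    Commute (crossHD j k) (crossDV k' i) := by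
  apply op2_commute <;> simp [hk]

theorem commute_crossDV_crossHV {i i' : ℕ} (hi : i ≠ i') (k j : ℕ) :
    Commute (crossDV k i) (crossHV j i') := by
  apply op2_commute <;> simp [hi]

theorem commute_crossDV_crossDV {k k' i i' : ℕ} (hk : k ≠ k') (hi : i ≠ i') :
    Commute (crossDV k i) (crossDV k' i') := by
  apply op2_commute <;> simp [hi, hk]

/-- A diagonal line moves through a piece of a horizontal line. -/
theorem segProd_yangBaxter (j k a l : ℕ) :
    segProd (crossDV k) a l * segProd (crossHV j) a l * crossHD j k =
      crossHD j k * segProd (crossHV j) a l * segProd (crossDV k) a l := by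
  induction l with
  | zero => simp
  | succ l ih =>
    have c1 : Commute (crossDV k (a + l)) (segProd (crossHV j) a l) :=
      commute_segProd fun i _ h2 => commute_crossDV_crossHV (by omega) _ _
    have c2 : Commute (crossHV j (a + l)) (segProd (crossDV k) a l) :=
      commute_segProd fun i _ h2 => (commute_crossDV_crossHV (by omega) _ _).symm
    rw [segProd_succ, segProd_succ]
    calc _ = segProd (crossDV k) a l * (crossDV k (a + l) * segProd (crossHV j) a l) *
          crossHV j (a + l) * crossHD j k := by simp only [mul_assoc]
      _ = segProd (crossDV k) a l * segProd (crossHV j) a l *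
          (crossDV k (a + l) * crossHV j (a + l) * crossHD j k) := by
            rw [c1.eq]; simp only [mul_assoc]
      _ = (segProd (crossDV k) a l * segProd (crossHV j) a l * crossHD j k) *
          crossHV j (a + l) * crossDV k (a + l) := by rw [yangBaxter]; simp only [mul_assoc]
      _ = crossHD j k * segProd (crossHV j) a l *
          (segProd (crossDV k) a l * crossHV j (a + l)) * crossDV k (a + l) := by
            rw [ih]; simp only [mul_assoc]
      _ = _ := by rw [← c2.eq]; simp only [mul_assoc]

/-- The node `(i, j)` of the grid where only the diagonal lines of index `lo ≤ k < hi` are kept. -/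
noncomputable def node (lo hi j i : ℕ) : LineOp :=
  if lo ≤ i + j ∧ i + j < hi then crossHD j (i + j) * crossHV j i * crossDV (i + j) i
  else crossHV j i

theorem node_of_lt {lo hi j i : ℕ} (h : i + j < lo) : node lo hi j i = crossHV j i :=
  if_neg (by omega)

theorem node_of_le {lo hi j i : ℕ} (h : hi ≤ i + j) : node lo hi j i = crossHV j i :=
  if_neg (by omega)

theorem node_of_mem {lo hi j i k : ℕ} (h1 : lo ≤ k) (h2 : k < hi) (hk : i + j = k) :
    node lo hi j i = crossHD j k * crossHV j i * crossDV k i := by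
  subst hk
  exact if_pos ⟨h1, h2⟩

theorem node_succ_left {lo hi j i : ℕ} (h : i + j ≠ lo) : node (lo + 1) hi j i = node lo hi j i := by
  unfold node
  congr 1
  simp only [eq_iff_iff]
  omega

theorem node_succ_right {lo hi j i : ℕ} (h : i + j ≠ hi) :
    node lo (hi + 1) j i = node lo hi j i := by
  unfold node
  congr 1
  simp only [eq_iff_iff]
  omega

theorem commute_crossDV_node {lo hi j i i' k : ℕ} (hii : i' ≠ i) (hk : k ≠ i + j) :
    Commute (crossDV k i') (node lo hi j i) := by
  unfold node
  split_ifs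
  · exact ((commute_crossHD_crossDV hk.symm _ _).symm.mul_right
      (commute_crossDV_crossHV hii _ _)).mul_right (commute_crossDV_crossDV hk hii)
  · exact commute_crossDV_crossHV hii _ _

theorem commute_crossHD_node {lo hi j j' i k : ℕ} (hj : j' ≠ j)
    (hk : k < lo ∨ hi ≤ k) : Commute (crossHD j' k) (node lo hi j i) := by
  unfold node
  split_ifs with hm
  · have hk' : k ≠ i + j := by omega
    exact ((commute_crossHD_crossHD hj hk').mul_right
      (commute_crossHD_crossHV hj _ _)).mul_right (commute_crossHD_crossDV hk' _ _)
  · exact commute_crossHD_crossHV hj _ _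

/-- The row `j` of the grid of width `n`. -/
noncomputable def row (n lo hi j : ℕ) : LineOp := segProd (node lo hi j) 0 n

/-- The first `r` rows of the grid of size `n`, counted from the top. -/
noncomputable def topRows (n lo hi r : ℕ) : LineOp :=
  segProd (fun s => row n lo hi (n - 1 - s)) 0 r

/-- The last `r` rows of the grid of size `n`. -/
noncomputable def bottomRows (n lo hi r : ℕ) : LineOp :=
  segProd (fun s => row n lo hi (n - 1 - s)) (n - r) r

theorem bottomRows_succ {n r : ℕ} (lo hi : ℕ) (hr : r < n) :
    bottomRows n lo hi (r + 1) = row n lo hi r * bottomRows n lo hi r := by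
  have h1 : n - 1 - (n - (r + 1)) = r := by omega
  have h2 : n - (r + 1) + 1 = n - r := by omega
  simp only [bottomRows, segProd_succ', h1, h2]

theorem topRows_eq_bottomRows (n lo hi : ℕ) : topRows n lo hi n = bottomRows n lo hi n := by
  simp [topRows, bottomRows]

/-- The diagonal `k` runs above the row over columns `0` to `m - 1` and goes through node `m`. West
of that node no diagonal is left, so Yang–Baxter pushes it below these columns; it then crosses the
horizontal line West of the grid. -/
theorem row_left_move {n k hi j m : ℕ} (hm : m + j = k) (hmn : m < n) (hk : k < hi) :
    segProd (crossDV k) 0 m * row n k hi j =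
      crossHD j k * row n (k + 1) hi j * segProd (crossDV k) 0 (m + 1) := by
  have e1 : segProd (node k hi j) 0 m = segProd (crossHV j) 0 m :=
    segProd_congr fun i _ h => node_of_lt (by omega)
  have e2 : segProd (node (k + 1) hi j) 0 m = segProd (crossHV j) 0 m :=
    segProd_congr fun i _ h => node_of_lt (by omega)
  have e3 : segProd (node (k + 1) hi j) (m + 1) (n - (m + 1)) =
      segProd (node k hi j) (m + 1) (n - (m + 1)) :=
    segProd_congr fun i h _ => node_succ_left (by omega)
  have c1 : Commute (crossHV j m) (segProd (crossDV k) 0 m) :=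
    commute_segProd fun i _ h2 => (commute_crossDV_crossHV (by omega) _ _).symm
  have c2 : Commute (segProd (crossDV k) 0 (m + 1))
      (segProd (node k hi j) (m + 1) (n - (m + 1))) :=
    segProd_commute_segProd fun i' _ h' i h _ => commute_crossDV_node (by omega) (by omega)
  unfold row
  rw [segProd_split _ hmn, segProd_split (node (k + 1) hi j) hmn, e1, e2, e3,
    node_of_mem le_rfl hk hm, node_of_lt (by omega : m + j < k + 1)]
  set rest := segProd (node k hi j) (m + 1) (n - (m + 1))
  calc _ = (segProd (crossDV k) 0 m * segProd (crossHV j) 0 m * crossHD j k) * crossHV j m *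
        crossDV k m * rest := by simp only [mul_assoc]
    _ = crossHD j k * segProd (crossHV j) 0 m * (segProd (crossDV k) 0 m * crossHV j m) *
        crossDV k m * rest := by rw [segProd_yangBaxter]; simp only [mul_assoc]
    _ = crossHD j k * segProd (crossHV j) 0 m * crossHV j m *
        (segProd (crossDV k) 0 (m + 1) * rest) := by
          rw [← c1.eq, segProd_succ, zero_add]; simp only [mul_assoc]
    _ = _ := by rw [c2.eq]; simp only [mul_assoc]

/-- Mirror image of `row_left_move`. The node `m` is first rewritten by `yangBaxter` so that its
diagonal passes Northeast; the nodes further East carry no diagonal. -/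
theorem row_right_move {n k lo j m : ℕ} (hm : m + j = k) (hmn : m < n) (hk : lo ≤ k) :
    row n lo (k + 1) j * segProd (crossDV k) (m + 1) (n - (m + 1)) =
      segProd (crossDV k) m (n - m) * row n lo k j * crossHD j k := by
  have e1 : segProd (node lo (k + 1) j) (m + 1) (n - (m + 1)) =
      segProd (crossHV j) (m + 1) (n - (m + 1)) :=
    segProd_congr fun i h _ => node_of_le (by omega)
  have e2 : segProd (node lo k j) (m + 1) (n - (m + 1)) =
      segProd (crossHV j) (m + 1) (n - (m + 1)) :=
    segProd_congr fun i h _ => node_of_le (by omega)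
  have e3 : segProd (node lo (k + 1) j) 0 m = segProd (node lo k j) 0 m :=
    segProd_congr fun i _ h => node_succ_right (by omega)
  have e4 : segProd (crossDV k) m (n - m) =
      crossDV k m * segProd (crossDV k) (m + 1) (n - (m + 1)) := by
    rw [← segProd_succ']
    congr 1
    omega
  have c1 : Commute (crossHV j m) (segProd (crossDV k) (m + 1) (n - (m + 1))) :=
    commute_segProd fun i h1 _ => (commute_crossDV_crossHV (by omega) _ _).symm
  have c2 : Commute (segProd (crossDV k) m (n - m)) (segProd (node lo k j) 0 m) :=
    segProd_commute_segProd fun i' h' _ i _ h => commute_crossDV_node (by omega) (by omega)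
  unfold row
  rw [segProd_split _ hmn, segProd_split (node lo k j) hmn, e1, e2, e3,
    node_of_mem hk (Nat.lt_succ_self k) hm, node_of_le (by omega : k ≤ m + j), ← yangBaxter]
  set pre := segProd (node lo k j) 0 m
  set sY := segProd (crossHV j) (m + 1) (n - (m + 1))
  set sZ := segProd (crossDV k) (m + 1) (n - (m + 1))
  calc _ = pre * crossDV k m * crossHV j m * (crossHD j k * sY * sZ) := by simp only [mul_assoc]
    _ = pre * crossDV k m * (crossHV j m * sZ) * sY * crossHD j k := by
          rw [← segProd_yangBaxter]; simp only [mul_assoc]; rfl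
    _ = pre * segProd (crossDV k) m (n - m) * crossHV j m * sY * crossHD j k := by
          rw [c1.eq, e4]; simp only [mul_assoc]
    _ = _ := by rw [← c2.eq]; simp only [mul_assoc]

/-! ### Pulling the diagonals out of the grid -/

/-- The initial states of the lines: the diagonal lines of index `k < t` are covered. -/
def initState (t : ℕ) : Line → Bool
  | h _ => true
  | d k => decide (k < t)
  | v _ => false

/-- The final states of the lines. -/
def finalState (n t : ℕ) : Line → Bool
  -- Lines outside the grid must keep their initial state, hence `true` for `n ≤ j` here and `false`
  -- below for `n ≤ i`.
  | h j => decide (n ≤ j)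
  | d k => decide (k < t)
  | v i => decide (i < n)

/-- South of the grid the vertical lines and the diagonals `k < t` are all covered: every crossing
is frozen. -/
theorem segProd_crossDV_ind {n t k l : ℕ} (hk : k < t) (hl : l ≤ n) :
    segProd (crossDV k) 0 l (ind (finalState n t)) = √2 ^ l • ind (finalState n t) := by
  induction l with
  | zero => simp
  | succ l ih =>
    have : finalState n t (d k) = finalState n t (v (0 + l)) := by
      simp only [finalState, decide_eq_decide]
      omega
    rw [segProd_succ, Module.End.mul_apply, crossDV, op2_wA_indicator (by simp) this, map_smul,
      ih (by omega), smul_smul, pow_succ']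

theorem segProd_crossDV_initState {t k : ℕ} (hk : t ≤ k) (a l : ℕ) (F : (Line → Bool) → ℝ) :
    segProd (crossDV k) a l F (initState t) = √2 ^ l * F (initState t) := by
  induction l generalizing F with
  | zero => simp
  | succ l ih =>
    rw [segProd_succ, Module.End.mul_apply, ih, crossDV, op2_wA_apply_of_eq, pow_succ, mul_assoc]
    simp only [initState, decide_eq_false_iff_not]
    omega

/-- The lowest diagonal line is pulled out to the Southwest. -/
theorem exists_topRows_left_move {n t k hi r : ℕ} (hk : k < t) (hkn : k < n) (hkh : k < hi)
    (hr : r ≤ n) :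
    ∃ P : LineOp, (∀ F, P F (initState t) = √2 ^ (k + 1 + r - n) * F (initState t)) ∧
      topRows n k hi r = P * topRows n (k + 1) hi r * segProd (crossDV k) 0 (k + 1 + r - n) := by
  -- The top `r` rows contain `k + 1 + r - n` nodes of the diagonal, truncated to 0 while they lie
  -- above it. `P` collects the crossings with the horizontal lines, pulled out to the West.
  induction r with
  | zero =>
    refine ⟨1, fun F => ?_, ?_⟩
    · simp [Nat.sub_eq_zero_of_le (show k + 1 ≤ n by omega)]
    · simp [Nat.sub_eq_zero_of_le (show k + 1 ≤ n by omega), topRows]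
  | succ r ih =>
    obtain ⟨P, hP, e⟩ := ih (by omega)
    have e1 : topRows n k hi (r + 1) = topRows n k hi r * row n k hi (n - 1 - r) := by
      rw [topRows, segProd_succ, zero_add]; rfl
    have e2 : topRows n (k + 1) hi (r + 1) =
        topRows n (k + 1) hi r * row n (k + 1) hi (n - 1 - r) := by
      rw [topRows, segProd_succ, zero_add]; rfl
    by_cases hj : k < n - 1 - r
    · refine ⟨P, ?_, ?_⟩
      · rw [show k + 1 + (r + 1) - n = k + 1 + r - n by omega]
        exact hP
      · have e3 : row n k hi (n - 1 - r) = row n (k + 1) hi (n - 1 - r) :=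
          segProd_congr fun i _ _ => (node_succ_left (by omega)).symm
        rw [e1, e2, e, e3, show k + 1 + r - n = 0 by omega,
          show k + 1 + (r + 1) - n = 0 by omega]
        simp only [segProd_zero, mul_one, mul_assoc]
    · obtain ⟨m, hm⟩ : ∃ m, m + (n - 1 - r) = k := ⟨k - (n - 1 - r), by omega⟩
      have hm1 : k + 1 + r - n = m := by omega
      have hm2 : k + 1 + (r + 1) - n = m + 1 := by omega
      rw [hm1] at hP e
      rw [hm2]
      have c : Commute (crossHD (n - 1 - r) k) (topRows n (k + 1) hi r) :=
        commute_segProd fun s _ hs => commute_segProd fun i _ _ =>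
          commute_crossHD_node (by omega) (by omega)
      -- The new crossing commutes with the rows above: they involve other horizontal lines and have
      -- already lost the diagonal `k`.
      refine ⟨P * crossHD (n - 1 - r) k, fun F => ?_, ?_⟩
      · rw [Module.End.mul_apply, hP, crossHD, op2_wA_apply_of_eq, pow_succ, mul_assoc]
        simp [initState, hk]
      · rw [e1, e2, e, mul_assoc, row_left_move hm (by omega) hkh]
        calc _ = P * (topRows n (k + 1) hi r * crossHD (n - 1 - r) k) *
              (row n (k + 1) hi (n - 1 - r)) * segProd (crossDV k) 0 (m + 1) := by
                simp only [mul_assoc]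
          _ = _ := by rw [← c.eq]; simp only [mul_assoc]

/-- The highest diagonal line is pulled out to the Northeast. -/
theorem exists_bottomRows_right_move {n t k lo r : ℕ} (hk : t ≤ k) (hkn : n ≤ k + 1)
    (hkh : lo ≤ k) (hr : r ≤ n) :
    ∃ P : LineOp,
      P (ind (finalState n t)) = √2 ^ (r + n - (k + 1)) • ind (finalState n t) ∧
      bottomRows n lo (k + 1) r =
        segProd (crossDV k) (k + 1 - r) (n - (k + 1 - r)) * bottomRows n lo k r * P := by
  -- The bottom `r` rows contain `r + n - (k + 1)` nodes of the diagonal, again truncated. `P` now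
  -- collects crossings to the East, where horizontal lines and this diagonal end uncovered.
  induction r with
  | zero =>
    refine ⟨1, ?_, ?_⟩
    · simp [Nat.sub_eq_zero_of_le hkn]
    · simp [Nat.sub_eq_zero_of_le hkn, bottomRows]
  | succ r ih =>
    obtain ⟨P, hP, e⟩ := ih (by omega)
    rw [bottomRows_succ _ _ (by omega), bottomRows_succ _ _ (by omega)]
    by_cases hj : n + r ≤ k
    · refine ⟨P, ?_, ?_⟩
      · rw [show r + 1 + n - (k + 1) = r + n - (k + 1) by omega]
        exact hP
      · have e3 : row n lo (k + 1) r = row n lo k r :=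
          segProd_congr fun i _ _ => node_succ_right (by omega)
        rw [e, e3, show n - (k + 1 - r) = 0 by omega, show n - (k + 1 - (r + 1)) = 0 by omega]
        simp only [segProd_zero, one_mul, mul_assoc]
    · obtain ⟨m, hm⟩ : ∃ m, m + r = k := ⟨k - r, by omega⟩
      rw [show k + 1 - r = m + 1 by omega] at e
      rw [show k + 1 - (r + 1) = m by omega]
      have c : Commute (crossHD r k) (bottomRows n lo k r) :=
        commute_segProd fun s _ hs => commute_segProd fun i _ _ =>
          commute_crossHD_node (by omega) (by omega)
      refine ⟨crossHD r k * P, ?_, ?_⟩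
      · have : finalState n t (h r) = finalState n t (d k) := by
          simp only [finalState, decide_eq_decide]
          omega
        rw [Module.End.mul_apply, hP, map_smul, crossHD, op2_wA_indicator (by simp) this,
          smul_smul, ← pow_succ]
        congr 2
        omega
      · rw [e, ← mul_assoc, ← mul_assoc, row_right_move hm (by omega) hkh]
        calc _ = segProd (crossDV k) m (n - m) * row n lo k r *
              (crossHD r k * bottomRows n lo k r) * P := by simp only [mul_assoc]
          _ = _ := by rw [c.eq]; simp only [mul_assoc]

/-- The matrix element of an operator between the initial and the final states. -/
noncomputable def elt (n t : ℕ) (P : LineOp) : ℝ := P (ind (finalState n t)) (initState t)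

theorem sqrt_two_pow_mul_self (m : ℕ) : √(2 : ℝ) ^ m * √2 ^ m = 2 ^ m := by
  rw [← mul_pow, sqrt_two_mul_self]

/-- The diagonal meets `k + 1` horizontal lines to the West and `k + 1` vertical lines to the South,
each with a factor √2. -/
theorem elt_left_move {n t k hi : ℕ} (hk : k < t) (hkn : k < n) (hkh : k < hi) :
    elt n t (topRows n k hi n) = 2 ^ (k + 1) * elt n t (topRows n (k + 1) hi n) := by
  obtain ⟨P, hP, e⟩ := exists_topRows_left_move hk hkn hkh le_rfl
  rw [Nat.add_sub_cancel] at hP e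
  rw [elt, e, mul_assoc, Module.End.mul_apply, hP, Module.End.mul_apply,
    segProd_crossDV_ind hk (by omega), map_smul, Pi.smul_apply, smul_eq_mul, ← mul_assoc,
    sqrt_two_pow_mul_self, elt]

theorem elt_right_move {n t k lo l : ℕ} (hk : t ≤ k) (hkn : n ≤ k + 1) (hkh : lo ≤ k)
    (hl : k + 1 + l = 2 * n) :
    elt n t (topRows n lo (k + 1) n) = 2 ^ l * elt n t (topRows n lo k n) := by
  obtain ⟨P, hP, e⟩ := exists_bottomRows_right_move hk hkn hkh (le_refl n)
  rw [show n + n - (k + 1) = l by omega] at hP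
  rw [show n - (k + 1 - n) = l by omega] at e
  rw [topRows_eq_bottomRows, topRows_eq_bottomRows, elt, e, mul_assoc, Module.End.mul_apply,
    segProd_crossDV_initState hk, Module.End.mul_apply, hP, map_smul, Pi.smul_apply, smul_eq_mul,
    ← mul_assoc, sqrt_two_pow_mul_self, elt]

theorem elt_left_moves {n t m hi : ℕ} (hm : m ≤ t) (hmn : m ≤ n) (hmh : m ≤ hi) :
    elt n t (topRows n 0 hi n) =
      2 ^ (∑ s ∈ Finset.range m, (s + 1)) * elt n t (topRows n m hi n) := by
  induction m with
  | zero => simp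
  | succ m ih =>
    rw [ih (by omega) (by omega) (by omega), elt_left_move (by omega) (by omega) (by omega),
      Finset.sum_range_succ, pow_add _ _ (m + 1), mul_assoc]

theorem elt_right_moves {n t lo l k : ℕ} (hk : t ≤ k) (hkn : n ≤ k + 1) (hlo : lo ≤ k)
    (hl : k + l + 1 = 2 * n) :
    elt n t (topRows n lo (2 * n - 1) n) =
      2 ^ (∑ s ∈ Finset.range l, (s + 1)) * elt n t (topRows n lo k n) := by
  induction l generalizing k with
  | zero => simp [show 2 * n - 1 = k by omega]
  | succ l ih =>
    rw [ih (k := k + 1) (by omega) (by omega) (by omega) (by omega),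
      elt_right_move (l := l + 1) hk hkn hlo (by omega), Finset.sum_range_succ, pow_add _ _ (l + 1), mul_assoc]

/-- All the diagonal lines are pulled out of the grid. -/
theorem elt_topRows_eq {n t : ℕ} (ht : t ≤ n) (ht' : n ≤ t + 1) (hn : 1 ≤ n) :
    elt n t (topRows n 0 (2 * n - 1) n) = 2 ^ n ^ 2 * elt n t (topRows n 0 0 n) := by
  -- Two consecutive triangular numbers add up to a square, here the number of nodes.
  have aux : ∀ m, ∑ s ∈ Finset.range (m + 1), (s + 1) + ∑ s ∈ Finset.range m, (s + 1) =
      (m + 1) ^ 2 := by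
    intro m
    induction m with
    | zero => simp
    | succ m ih =>
      rw [Finset.sum_range_succ _ (m + 1), Finset.sum_range_succ _ m]
      rw [Finset.sum_range_succ _ m] at ih
      nlinarith
  have hempty : topRows n t t n = topRows n 0 0 n :=
    segProd_congr fun s _ _ => segProd_congr fun i _ _ => by
      rw [node, node, if_neg (by omega), if_neg (by omega)]
  rw [elt_left_moves le_rfl ht (show t ≤ 2 * n - 1 by omega),
    elt_right_moves (l := 2 * n - 1 - t) (k := t) le_rfl ht' le_rfl (by omega), ← mul_assoc,
    ← pow_add, hempty]
  congr 2
  obtain ⟨m, rfl⟩ : ∃ m, n = m + 1 := ⟨n - 1, by omega⟩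
  -- The main diagonal `k = n - 1` leaves to the Northeast in the first case, to the Southwest in
  -- the second.
  obtain rfl | rfl : t = m ∨ t = m + 1 := by omega
  · rw [show 2 * (t + 1) - 1 - t = t + 1 by omega, ← aux, add_comm]
  · rw [show 2 * (m + 1) - 1 - (m + 1) = m by omega, ← aux]

/-! ### Products of crossings as sums over sets of covered edges -/

/-- The piece of a line after a given number of its nodes. -/
abbrev LineEdge : Type := (_ : Line) × ℕ

/-- Insert an edge into a set of edges if the Boolean is true. -/
def insertIf (x : Bool) (e : LineEdge) (A : Finset LineEdge) : Finset LineEdge :=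
  if x then insert e A else A

theorem mem_insertIf {x : Bool} {e e' : LineEdge} {A : Finset LineEdge} :
    e' ∈ insertIf x e A ↔ (e' = e ∧ x = true) ∨ e' ∈ A := by
  cases x <;> simp [insertIf]

theorem sum_powerset_insert_eq {e : LineEdge} {U : Finset LineEdge} (he : e ∉ U)
    (f : Finset LineEdge → ℝ) :
    ∑ A ∈ (insert e U).powerset, f A = ∑ A ∈ U.powerset, ∑ x, f (insertIf x e A) := by
  rw [Finset.sum_powerset_insert he, ← Finset.sum_add_distrib]
  refine Finset.sum_congr rfl fun A _ => ?_
  rw [Fintype.sum_bool, add_comm]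
  rfl

section Clock

variable (Λ : Finset Line) (σ₀ : Line → Bool) (κ₀ : Line → ℕ)

/-- The edges met by the lines between the times `κ₀` and `κ`. -/
def clockEdges (κ : Line → ℕ) : Finset LineEdge := Λ.sigma fun l => Finset.Ioc (κ₀ l) (κ l)

/-- The state of the line `l` at time `τ`, when `A` is the set of covered edges. -/
def lineBit (A : Finset LineEdge) (l : Line) (τ : ℕ) : Bool :=
  if τ ≤ κ₀ l then σ₀ l else decide (⟨l, τ⟩ ∈ A)

/-- The operator `P` is a sum over the sets of covered edges with weight `g`. -/
structure IsStateSum (P : LineOp) (κ : Line → ℕ) (g : Finset LineEdge → ℝ) : Prop where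
  apply_eq : ∀ F, P F σ₀ = ∑ A ∈ (clockEdges Λ κ₀ κ).powerset,
    g A * F fun l => lineBit σ₀ κ₀ A l (κ l)
  -- The weight depends only on edges already met, so inserting later edges leaves it unchanged.
  congr : ∀ A B, (∀ l τ, τ ≤ κ l → lineBit σ₀ κ₀ A l τ = lineBit σ₀ κ₀ B l τ) → g A = g B

variable {Λ σ₀ κ₀}

theorem lineBit_insertIf_of_ne {x : Bool} {e : LineEdge} {A : Finset LineEdge} {l : Line} {τ : ℕ}
    (h : (⟨l, τ⟩ : LineEdge) ≠ e) :
    lineBit σ₀ κ₀ (insertIf x e A) l τ = lineBit σ₀ κ₀ A l τ := by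
  simp [lineBit, mem_insertIf, h]

theorem lineBit_insertIf_self {x : Bool} {A : Finset LineEdge} {l : Line} {τ : ℕ}
    (hτ : κ₀ l < τ) (hA : (⟨l, τ⟩ : LineEdge) ∉ A) :
    lineBit σ₀ κ₀ (insertIf x ⟨l, τ⟩ A) l τ = x := by
  simp [lineBit, mem_insertIf, hA, hτ]

/-- The crossing creates one fresh edge on each of its three lines. Its sum over outgoing states
becomes the choice of which of these edges belong to `A`. -/
theorem IsStateSum.mul_op3 {P : LineOp} {κ κ' : Line → ℕ} {g : Finset LineEdge → ℝ}
    (H : IsStateSum Λ σ₀ κ₀ P κ g) (w : Bool → Bool → Bool → Bool → Bool → Bool → ℝ)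
    {a b c : Line} (hab : a ≠ b) (hac : a ≠ c) (hbc : b ≠ c) (ha : a ∈ Λ) (hb : b ∈ Λ)
    (hc : c ∈ Λ) (ka : κ₀ a ≤ κ a) (kb : κ₀ b ≤ κ b) (kc : κ₀ c ≤ κ c)
    (ka' : κ' a = κ a + 1) (kb' : κ' b = κ b + 1) (kc' : κ' c = κ c + 1)
    (hκ : ∀ l, l ≠ a → l ≠ b → l ≠ c → κ' l = κ l) :
    IsStateSum Λ σ₀ κ₀ (P * op3 w a b c) κ' fun A => g A *
      w (lineBit σ₀ κ₀ A a (κ a)) (lineBit σ₀ κ₀ A b (κ b)) (lineBit σ₀ κ₀ A c (κ c))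
        (lineBit σ₀ κ₀ A a (κ a + 1)) (lineBit σ₀ κ₀ A b (κ b + 1))
        (lineBit σ₀ κ₀ A c (κ c + 1)) := by
  have hmono : ∀ l, κ l ≤ κ' l := by
    intro l
    by_cases h1 : l = a
    · subst h1; omega
    by_cases h2 : l = b
    · subst h2; omega
    by_cases h3 : l = c
    · subst h3; omega
    exact (hκ l h1 h2 h3).ge
  have hU : clockEdges Λ κ₀ κ' =
      insert ⟨c, κ c + 1⟩ (insert ⟨b, κ b + 1⟩ (insert ⟨a, κ a + 1⟩ (clockEdges Λ κ₀ κ))) := by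
    ext ⟨l, τ⟩
    simp only [clockEdges, Finset.mem_insert, Finset.mem_sigma, Finset.mem_Ioc, Sigma.mk.injEq,
      heq_eq_eq]
    by_cases h1 : l = a
    · subst h1
      simp only [hab, hac, ha, ka', true_and, false_and, false_or]
      omega
    by_cases h2 : l = b
    · subst h2
      simp only [hbc, hab.symm, hb, kb', true_and, false_and, false_or]
      omega
    by_cases h3 : l = c
    · subst h3
      simp only [hac.symm, hbc.symm, hc, kc', true_and, false_and, false_or]
      omega
    simp [h1, h2, h3, hκ l h1 h2 h3]
  have na : (⟨a, κ a + 1⟩ : LineEdge) ∉ clockEdges Λ κ₀ κ := by simp [clockEdges]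
  have nb : (⟨b, κ b + 1⟩ : LineEdge) ∉ clockEdges Λ κ₀ κ := by simp [clockEdges]
  have nc : (⟨c, κ c + 1⟩ : LineEdge) ∉ clockEdges Λ κ₀ κ := by simp [clockEdges]
  have nb' : (⟨b, κ b + 1⟩ : LineEdge) ∉ insert ⟨a, κ a + 1⟩ (clockEdges Λ κ₀ κ) := by
    simp [nb, hab.symm]
  have nc' : (⟨c, κ c + 1⟩ : LineEdge) ∉
      insert ⟨b, κ b + 1⟩ (insert ⟨a, κ a + 1⟩ (clockEdges Λ κ₀ κ)) := by
    simp [nc, hac.symm, hbc.symm]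
  refine ⟨fun F => ?_, fun A B h => ?_⟩
  · rw [Module.End.mul_apply, H.apply_eq, hU, sum_powerset_insert_eq nc',
      sum_powerset_insert_eq nb', sum_powerset_insert_eq na]
    refine Finset.sum_congr rfl fun A hA => ?_
    rw [Finset.mem_powerset] at hA
    rw [op3_apply, Finset.mul_sum]
    refine Finset.sum_congr rfl fun x _ => ?_
    rw [Finset.mul_sum]
    refine Finset.sum_congr rfl fun y _ => ?_
    rw [Finset.mul_sum]
    refine Finset.sum_congr rfl fun z _ => ?_
    set A' := insertIf z ⟨c, κ c + 1⟩ (insertIf y ⟨b, κ b + 1⟩ (insertIf x ⟨a, κ a + 1⟩ A))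
      with hA'
    have hold : ∀ l τ, τ ≤ κ l → lineBit σ₀ κ₀ A' l τ = lineBit σ₀ κ₀ A l τ := by
      intro l τ hτ
      have aux : ∀ l', (⟨l, τ⟩ : LineEdge) ≠ ⟨l', κ l' + 1⟩ := by
        intro l' e
        simp only [Sigma.mk.injEq, heq_eq_eq] at e
        obtain ⟨rfl, e⟩ := e
        omega
      rw [hA', lineBit_insertIf_of_ne (aux c), lineBit_insertIf_of_ne (aux b),
        lineBit_insertIf_of_ne (aux a)]
    have hba : (⟨a, κ a + 1⟩ : LineEdge) ≠ ⟨b, κ b + 1⟩ := by simp [hab]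
    have hca : (⟨a, κ a + 1⟩ : LineEdge) ≠ ⟨c, κ c + 1⟩ := by simp [hac]
    have hcb : (⟨b, κ b + 1⟩ : LineEdge) ≠ ⟨c, κ c + 1⟩ := by simp [hbc]
    have hx : lineBit σ₀ κ₀ A' a (κ a + 1) = x := by
      rw [hA', lineBit_insertIf_of_ne hca, lineBit_insertIf_of_ne hba,
        lineBit_insertIf_self (by omega) fun h => na (hA h)]
    have hy : lineBit σ₀ κ₀ A' b (κ b + 1) = y := by
      rw [hA', lineBit_insertIf_of_ne hcb, lineBit_insertIf_self (by omega)]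
      simp only [mem_insertIf, hba.symm, false_and, false_or]
      exact fun h => nb (hA h)
    have hz : lineBit σ₀ κ₀ A' c (κ c + 1) = z := by
      rw [hA', lineBit_insertIf_self (by omega)]
      simp only [mem_insertIf, hca.symm, hcb.symm, false_and, false_or]
      exact fun h => nc (hA h)
    rw [hx, hy, hz, H.congr A' A hold, hold a _ le_rfl, hold b _ le_rfl, hold c _ le_rfl,
      mul_assoc]
    congr 3
    ext l
    by_cases h3 : l = c
    · subst h3
      rw [update_self, kc', hz]
    rw [update_of_ne h3]
    by_cases h2 : l = b
    · subst h2
      rw [update_self, kb', hy]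
    rw [update_of_ne h2]
    by_cases h1 : l = a
    · subst h1
      rw [update_self, ka', hx]
    rw [update_of_ne h1, hκ l h1 h2 h3, hold l _ le_rfl]
  · rw [H.congr A B fun l τ hτ => h l τ (hτ.trans (hmono l)), h a _ (hmono a), h b _ (hmono b),
      h c _ (hmono c), ← ka', ← kb', ← kc', h a _ le_rfl, h b _ le_rfl, h c _ le_rfl]

end Clock

/-! ### State sum of the grid -/

/-- The time reached by each line when `r` rows and `i` nodes of the next row are done. -/
def gridClock (n r i : ℕ) : Line → ℕ
  -- Clocks show the abscissa on horizontal and diagonal lines and the number of rows passed on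
  -- vertical ones. Lines outside the grid have constant clocks.
  | h j => if n ≤ j + r then n else if j + r + 1 = n then i else 0
  | d k => if k + r + 1 < i + n then k + r + 2 - n else min (k + r + 1 - n) n
  | v i' => if i' < i then r + 1 else if i' < n then r else 0

/-- The lines that cross the grid of size `n`. -/
def gridLines (n : ℕ) : Finset Line :=
  (Finset.range n).image h ∪ (Finset.range (2 * n - 1)).image d ∪ (Finset.range n).image v

theorem h_mem_gridLines {n j : ℕ} : h j ∈ gridLines n ↔ j < n := by simp [gridLines]

theorem d_mem_gridLines {n k : ℕ} : d k ∈ gridLines n ↔ k < 2 * n - 1 := by simp [gridLines]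

theorem v_mem_gridLines {n i : ℕ} : v i ∈ gridLines n ↔ i < n := by simp [gridLines]

theorem gridClock_row_end (n r : ℕ) : gridClock n r n = gridClock n (r + 1) 0 := by
  ext l
  cases l <;> simp only [gridClock] <;> split_ifs <;> omega

/-- The state of a line of the grid. -/
def gridBit (n t : ℕ) (A : Finset LineEdge) (l : Line) (τ : ℕ) : Bool :=
  lineBit (initState t) (gridClock n 0 0) A l τ

/-- The weight of the node `(i, n - 1 - s)`, when `A` is the set of covered edges. -/
def gridNodeWeight (w : Bool → Bool → Bool → Bool → Bool → Bool → ℝ) (n t : ℕ)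
    (A : Finset LineEdge) (i s : ℕ) : ℝ :=
  w (gridBit n t A (h (n - 1 - s)) i) (gridBit n t A (d (i + (n - 1 - s))) i)
    (gridBit n t A (v i) s) (gridBit n t A (h (n - 1 - s)) (i + 1))
    (gridBit n t A (d (i + (n - 1 - s))) (i + 1)) (gridBit n t A (v i) (s + 1))

/-- The row `j` of a grid of triple crossings. -/
def row3 (w : Bool → Bool → Bool → Bool → Bool → Bool → ℝ) (n j : ℕ) : LineOp :=
  segProd (fun i => op3 w (h j) (d (i + j)) (v i)) 0 n

/-- The grid of triple crossings. -/
def grid3 (w : Bool → Bool → Bool → Bool → Bool → Bool → ℝ) (n : ℕ) : LineOp :=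
  segProd (fun s => row3 w n (n - 1 - s)) 0 n

theorem isStateSum_row (w : Bool → Bool → Bool → Bool → Bool → Bool → ℝ) {n t r m : ℕ}
    (hr : r < n) (hm : m ≤ n) {P : LineOp} {g : Finset LineEdge → ℝ}
    (H : IsStateSum (gridLines n) (initState t) (gridClock n 0 0) P (gridClock n r 0) g) :
    IsStateSum (gridLines n) (initState t) (gridClock n 0 0)
      (P * segProd (fun i => op3 w (h (n - 1 - r)) (d (i + (n - 1 - r))) (v i)) 0 m)
      (gridClock n r m) fun A => g A * ∏ i ∈ Finset.range m, gridNodeWeight w n t A i r := by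
  induction m with
  | zero => simpa using H
  | succ m ih =>
    have eh : gridClock n r m (h (n - 1 - r)) = m := by
      simp only [gridClock]; split_ifs <;> omega
    have ed : gridClock n r m (d (m + (n - 1 - r))) = m := by
      simp only [gridClock]; split_ifs <;> omega
    have ev : gridClock n r m (v m) = r := by
      simp only [gridClock]; split_ifs <;> omega
    have key := (ih (by omega)).mul_op3 (κ' := gridClock n r (m + 1)) w (a := h (n - 1 - r))
      (b := d (m + (n - 1 - r))) (c := v m) (by simp) (by simp) (by simp)
      (h_mem_gridLines.2 (by omega)) (d_mem_gridLines.2 (by omega)) (v_mem_gridLines.2 (by omega))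
      (by simp only [gridClock]; split_ifs <;> omega)
      (by simp only [gridClock]; split_ifs <;> omega)
      (by simp only [gridClock]; split_ifs <;> omega)
      (by simp only [gridClock]; split_ifs <;> omega)
      (by simp only [gridClock]; split_ifs <;> omega)
      (by simp only [gridClock]; split_ifs <;> omega)
      (by
        intro l h1 h2 h3
        cases l <;> simp only [ne_eq, h.injEq, d.injEq, v.injEq] at h1 h2 h3 <;>
          simp only [gridClock] <;> split_ifs <;> omega)
    rw [eh, ed, ev] at key
    rw [segProd_succ, zero_add, ← mul_assoc]
    simp only [Finset.prod_range_succ, ← mul_assoc]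
    exact key

theorem isStateSum_grid (w : Bool → Bool → Bool → Bool → Bool → Bool → ℝ) {n t r : ℕ}
    (hr : r ≤ n) :
    IsStateSum (gridLines n) (initState t) (gridClock n 0 0)
      (segProd (fun s => row3 w n (n - 1 - s)) 0 r) (gridClock n r 0)
      fun A => ∏ s ∈ Finset.range r, ∏ i ∈ Finset.range n, gridNodeWeight w n t A i s := by
  induction r with
  | zero =>
    refine ⟨fun F => ?_, fun A B _ => rfl⟩
    have e : clockEdges (gridLines n) (gridClock n 0 0) (gridClock n 0 0) = ∅ := by
      ext
      simp [clockEdges]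
    simp [e, lineBit]
  | succ r ih =>
    have key := isStateSum_row w (by omega) le_rfl (ih (by omega))
    rw [gridClock_row_end] at key
    rw [segProd_succ, zero_add]
    simp only [Finset.prod_range_succ]
    exact key

theorem elt_grid3 (w : Bool → Bool → Bool → Bool → Bool → Bool → ℝ) (n t : ℕ) :
    elt n t (grid3 w n) =
      ∑ A ∈ (clockEdges (gridLines n) (gridClock n 0 0) (gridClock n n 0)).powerset,
        (∏ s ∈ Finset.range n, ∏ i ∈ Finset.range n, gridNodeWeight w n t A i s) *
          ind (finalState n t) fun l => gridBit n t A l (gridClock n n 0 l) :=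
  (isStateSum_grid w le_rfl).apply_eq _

/-! ### Sets of covered edges and orientations -/

/-- The boundary states of the lines: the diagonal lines of index `k < t` are covered. -/
def TriOrientation.BoundaryState {n : ℕ} (t : ℕ) (σ : TriOrientation n) : Prop :=
  σ.toSquareOrientation.DWBC ∧
    ∀ e : DiagEdge n, (e.1.1 = 0 ∨ e.1.2 = 0 ∨ e.1.1 = Fin.last n ∨ e.1.2 = Fin.last n) →
      σ.diag e = decide ((e.1.1 : ℕ) + e.1.2 - 1 < t)

/-- The orientation of the edges of the grid where the edges of `A` are covered. -/
def triOfEdges (n t : ℕ) (A : Finset LineEdge) : TriOrientation n where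
  hor x j := gridBit n t A (h j) x
  ver i y := gridBit n t A (v i) (n - y)
  diag e := gridBit n t A (d ((e.1.1 : ℕ) + e.1.2 - 1)) e.1.1

/-- The state of the line `l` at time `τ`, in terms of the orientation of the edges. -/
def triBit {n : ℕ} (σ : TriOrientation n) : Line → ℕ → Bool
  | h j, τ => if H : j < n ∧ τ < n + 1 then σ.hor ⟨τ, H.2⟩ ⟨j, H.1⟩ else false
  | v i, τ => if H : i < n ∧ n - τ < n + 1 then σ.ver ⟨i, H.1⟩ ⟨n - τ, H.2⟩ else false
  -- The two coordinates add up to `k + 1`, strictly between `0` and `2 * n`: this excludes the two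
  -- segments that touch no node.
  | d k, τ => if H : τ < n + 1 ∧ k + 1 - τ < n + 1 ∧ τ ≤ k + 1 ∧ k + 1 < 2 * n then
      σ.diag ⟨(⟨τ, H.1⟩, ⟨k + 1 - τ, H.2.1⟩), by
        simp only [ne_eq, Prod.mk.injEq, Fin.ext_iff, Fin.val_zero, Fin.val_last]
        omega⟩ else false

/-- All the edges of the grid. -/
def gridEdges (n : ℕ) : Finset LineEdge :=
  clockEdges (gridLines n) (gridClock n 0 0) (gridClock n n 0)

theorem mem_gridEdges {n : ℕ} {l : Line} {τ : ℕ} :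
    (⟨l, τ⟩ : LineEdge) ∈ gridEdges n ↔
      l ∈ gridLines n ∧ gridClock n 0 0 l < τ ∧ τ ≤ gridClock n n 0 l := by
  simp [gridEdges, clockEdges]

/-- The set of the covered edges. -/
def edgesOfTri {n : ℕ} (σ : TriOrientation n) : Finset LineEdge :=
  (gridEdges n).filter fun e => triBit σ e.1 e.2

theorem triBit_triOfEdges {n t : ℕ} (A : Finset LineEdge) {l : Line} {τ : ℕ}
    (hl : l ∈ gridLines n) (h1 : gridClock n 0 0 l ≤ τ) (h2 : τ ≤ gridClock n n 0 l) :
    triBit (triOfEdges n t A) l τ = gridBit n t A l τ := by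
  cases l with
  | h j =>
    rw [h_mem_gridLines] at hl
    have : τ < n + 1 := by simp only [gridClock] at h2; split_ifs at h2 <;> omega
    simp [triBit, triOfEdges, hl, this]
  | d k =>
    rw [d_mem_gridLines] at hl
    have H : τ < n + 1 ∧ k + 1 - τ < n + 1 ∧ τ ≤ k + 1 ∧ k + 1 < 2 * n := by
      simp only [gridClock] at h1 h2; split_ifs at h1 h2 <;> omega
    simp only [triBit, triOfEdges, H, and_self, dif_pos]
    congr 2
    omega
  | v i =>
    rw [v_mem_gridLines] at hl
    have : τ ≤ n := by simp only [gridClock] at h2; split_ifs at h2 <;> omega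
    have e : n - (n - τ) = τ := by omega
    have e' : n - τ < n + 1 := by omega
    simp [triBit, triOfEdges, hl, e, e']

theorem triBit_init {n t : ℕ} {σ : TriOrientation n} (hσ : σ.BoundaryState t) {l : Line}
    (hl : l ∈ gridLines n) : triBit σ l (gridClock n 0 0 l) = initState t l := by
  obtain ⟨⟨h1, -, -, h4⟩, h5⟩ := hσ
  cases l with
  | h j =>
    rw [h_mem_gridLines] at hl
    have e : gridClock n 0 0 (h j) = 0 := by simp only [gridClock]; split_ifs <;> omega
    rw [e]
    simpa [triBit, hl, initState] using h1 ⟨j, hl⟩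
  | d k =>
    rw [d_mem_gridLines] at hl
    have e : gridClock n 0 0 (d k) = k + 1 - n := by simp only [gridClock]; split_ifs <;> omega
    have H : k + 1 - n < n + 1 ∧ k + 1 - (k + 1 - n) < n + 1 ∧ k + 1 - n ≤ k + 1 ∧
      k + 1 < 2 * n := by omega
    rw [e]
    simp only [triBit, H, and_self, dif_pos]
    rw [h5]
    · simp only [initState, decide_eq_decide]
      omega
    · simp only [Fin.ext_iff, Fin.val_zero, Fin.val_last]
      omega
  | v i =>
    rw [v_mem_gridLines] at hl
    have e : gridClock n 0 0 (v i) = 0 := by simp only [gridClock]; split_ifs <;> omega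
    rw [e]
    have := h4 ⟨i, hl⟩
    simp only [triBit, hl, initState, true_and, Nat.sub_zero, Nat.lt_succ_self, dif_pos]
    exact this

theorem triBit_final {n t : ℕ} {σ : TriOrientation n} (hσ : σ.BoundaryState t) {l : Line}
    (hl : l ∈ gridLines n) : triBit σ l (gridClock n n 0 l) = finalState n t l := by
  obtain ⟨⟨-, h2, h3, -⟩, h5⟩ := hσ
  cases l with
  | h j =>
    rw [h_mem_gridLines] at hl
    have e : gridClock n n 0 (h j) = n := by simp only [gridClock]; split_ifs <;> omega
    rw [e]
    have := h2 ⟨j, hl⟩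
    simp only [triBit, hl, finalState, true_and, Nat.lt_succ_self, dif_pos, Nat.not_le.2 hl,
      decide_false]
    exact this
  | d k =>
    rw [d_mem_gridLines] at hl
    have e : gridClock n n 0 (d k) = min (k + 1) n := by
      simp only [gridClock]; split_ifs <;> omega
    have H : min (k + 1) n < n + 1 ∧ k + 1 - min (k + 1) n < n + 1 ∧ min (k + 1) n ≤ k + 1 ∧
      k + 1 < 2 * n := by omega
    rw [e]
    simp only [triBit, H, and_self, dif_pos]
    rw [h5]
    · simp only [finalState, decide_eq_decide]
      omega
    · simp only [Fin.ext_iff, Fin.val_zero, Fin.val_last]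
      omega
  | v i =>
    rw [v_mem_gridLines] at hl
    have e : gridClock n n 0 (v i) = n := by simp only [gridClock]; split_ifs <;> omega
    rw [e]
    simpa [triBit, hl, finalState] using h3 ⟨i, hl⟩

theorem gridBit_edgesOfTri {n t : ℕ} {σ : TriOrientation n} (hσ : σ.BoundaryState t) {l : Line}
    {τ : ℕ} (hl : l ∈ gridLines n) (h1 : gridClock n 0 0 l ≤ τ) (h2 : τ ≤ gridClock n n 0 l) :
    gridBit n t (edgesOfTri σ) l τ = triBit σ l τ := by
  rcases h1.eq_or_lt with rfl | h1
  · rw [triBit_init hσ hl, gridBit, lineBit, if_pos le_rfl]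
  · rw [gridBit, lineBit, if_neg (by omega)]
    simp [edgesOfTri, mem_gridEdges, hl, h1, h2]

theorem gridBit_final_edgesOfTri {n t : ℕ} {σ : TriOrientation n} (hσ : σ.BoundaryState t)
    (l : Line) : gridBit n t (edgesOfTri σ) l (gridClock n n 0 l) = finalState n t l := by
  by_cases hl : l ∈ gridLines n
  · rw [gridBit_edgesOfTri hσ hl _ le_rfl, triBit_final hσ hl]
    cases l <;> simp only [gridClock] <;> split_ifs <;> omega
  -- A line outside the grid never advances, and its initial and final states agree.
  · have e : gridClock n n 0 l ≤ gridClock n 0 0 l := by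
      cases l with
      | h j => rw [h_mem_gridLines] at hl; simp only [gridClock]; split_ifs <;> omega
      | d k => rw [d_mem_gridLines] at hl; simp only [gridClock]; split_ifs <;> omega
      | v i => rw [v_mem_gridLines] at hl; simp only [gridClock]; split_ifs <;> omega
    rw [gridBit, lineBit, if_pos e]
    cases l with
    | h j => rw [h_mem_gridLines] at hl; simp [initState, finalState]; omega
    | d k => rfl
    | v i => rw [v_mem_gridLines] at hl; simp [initState, finalState]; omega

theorem triOfEdges_edgesOfTri {n t : ℕ} {σ : TriOrientation n} (hσ : σ.BoundaryState t) :
    triOfEdges n t (edgesOfTri σ) = σ := by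
  have hh : (triOfEdges n t (edgesOfTri σ)).hor = σ.hor := by
    ext x j
    have hl : h j ∈ gridLines n := h_mem_gridLines.2 j.2
    have h1 : gridClock n 0 0 (h j) ≤ x := by simp only [gridClock]; split_ifs <;> omega
    have h2 : x ≤ gridClock n n 0 (h j) := by simp only [gridClock]; split_ifs <;> omega
    simp only [triOfEdges, gridBit_edgesOfTri hσ hl h1 h2]
    simp [triBit]
    omega
  have hv : (triOfEdges n t (edgesOfTri σ)).ver = σ.ver := by
    ext i y
    have hl : v i ∈ gridLines n := v_mem_gridLines.2 i.2
    have h1 : gridClock n 0 0 (v i) ≤ n - y := by simp only [gridClock]; split_ifs <;> omega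
    have h2 : n - y ≤ gridClock n n 0 (v i) := by simp only [gridClock]; split_ifs <;> omega
    simp only [triOfEdges, gridBit_edgesOfTri hσ hl h1 h2]
    have e : n - (n - (y : ℕ)) = y := by omega
    simp [triBit, e]
    omega
  have hd : (triOfEdges n t (edgesOfTri σ)).diag = σ.diag := by
    ext ⟨⟨x, y⟩, hne⟩
    have hxy : ¬ ((x : ℕ) = 0 ∧ (y : ℕ) = 0) ∧ ¬ ((x : ℕ) = n ∧ (y : ℕ) = n) := by
      have hne' := hne
      simp only [ne_eq, Prod.mk.injEq, Fin.ext_iff, Fin.val_zero, Fin.val_last] at hne'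
      exact hne'
    have hl : d ((x : ℕ) + y - 1) ∈ gridLines n := d_mem_gridLines.2 (by omega)
    have h1 : gridClock n 0 0 (d ((x : ℕ) + y - 1)) ≤ x := by
      simp only [gridClock]; split_ifs <;> omega
    have h2 : x ≤ gridClock n n 0 (d ((x : ℕ) + y - 1)) := by
      simp only [gridClock]; split_ifs <;> omega
    simp only [triOfEdges, gridBit_edgesOfTri hσ hl h1 h2]
    have H : (x : ℕ) < n + 1 ∧ (x : ℕ) + y - 1 + 1 - x < n + 1 ∧ (x : ℕ) ≤ x + y - 1 + 1 ∧
      (x : ℕ) + y - 1 + 1 < 2 * n := by omega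
    have e : (x : ℕ) + y - 1 + 1 - x = y := by omega
    rw [triBit, dif_pos H]
    simp only [e]
  exact TriOrientation.ext hh hv hd

theorem edgesOfTri_triOfEdges {n t : ℕ} {A : Finset LineEdge} (hA : A ⊆ gridEdges n) :
    edgesOfTri (triOfEdges n t A) = A := by
  ext ⟨l, τ⟩
  rw [edgesOfTri, Finset.mem_filter]
  constructor
  · rintro ⟨he, hb⟩
    rw [mem_gridEdges] at he
    rw [triBit_triOfEdges A he.1 he.2.1.le he.2.2, gridBit, lineBit, if_neg (by omega)] at hb
    exact of_decide_eq_true hb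
  · intro he
    refine ⟨hA he, ?_⟩
    have he' := mem_gridEdges.1 (hA he)
    rw [triBit_triOfEdges A he'.1 he'.2.1.le he'.2.2, gridBit, lineBit, if_neg (by omega)]
    exact decide_eq_true he

theorem boundaryState_triOfEdges {n t : ℕ} {A : Finset LineEdge}
    (hA : ∀ l, gridBit n t A l (gridClock n n 0 l) = finalState n t l) :
    (triOfEdges n t A).BoundaryState t := by
  refine ⟨⟨fun j => ?_, fun j => ?_, fun i => ?_, fun i => ?_⟩, ?_⟩
  · simp [triOfEdges, gridBit, lineBit, initState]
  · have e : gridClock n n 0 (h j) = n := by simp only [gridClock]; split_ifs <;> omega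
    have := hA (h j)
    rw [e] at this
    simpa [triOfEdges, finalState, Nat.not_le.2 j.2] using this
  · have e : gridClock n n 0 (v i) = n := by simp only [gridClock]; split_ifs <;> omega
    have := hA (v i)
    rw [e] at this
    simpa [triOfEdges, finalState] using this
  · simp [triOfEdges, gridBit, lineBit, initState]
  · rintro ⟨⟨x, y⟩, hne⟩ hb
    have hxy : ¬ ((x : ℕ) = 0 ∧ (y : ℕ) = 0) ∧ ¬ ((x : ℕ) = n ∧ (y : ℕ) = n) := by
      have hne' := hne
      simp only [ne_eq, Prod.mk.injEq, Fin.ext_iff, Fin.val_zero, Fin.val_last] at hne'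
      exact hne'
    simp only [Fin.ext_iff, Fin.val_zero, Fin.val_last] at hb
    -- A diagonal boundary edge is the first or the last edge of its diagonal.
    have hb' : (x : ℕ) ≤ gridClock n 0 0 (d ((x : ℕ) + y - 1)) ∨
        gridClock n n 0 (d ((x : ℕ) + y - 1)) = x := by
      simp only [gridClock]; split_ifs <;> omega
    rcases hb' with hb' | hb'
    · simp only [triOfEdges, gridBit, lineBit, if_pos hb', initState]
    · have := hA (d ((x : ℕ) + y - 1))
      rw [hb'] at this
      exact this

theorem prod_gridNodeWeight (w : Bool → Bool → Bool → Bool → Bool → Bool → ℝ) (n t : ℕ)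
    (A : Finset LineEdge) :
    ∏ s ∈ Finset.range n, ∏ i ∈ Finset.range n, gridNodeWeight w n t A i s =
      let σ := triOfEdges n t A
      ∏ i : Fin n, ∏ j : Fin n, w (σ.west i j) (σ.northwest i j) (σ.north i j)
        (σ.east i j) (σ.southeast i j) (σ.south i j) := by
  simp only
  rw [Finset.prod_comm, ← Fin.prod_univ_eq_prod_range (fun i =>
    ∏ s ∈ Finset.range n, gridNodeWeight w n t A i s) n]
  refine Finset.prod_congr rfl fun i _ => ?_
  -- Operator rows are counted from the top, grid ordinates from the bottom.
  rw [← Finset.prod_range_reflect,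
    ← Fin.prod_univ_eq_prod_range (fun s => gridNodeWeight w n t A i (n - 1 - s)) n]
  refine Finset.prod_congr rfl fun j _ => ?_
  have e1 : n - 1 - (n - 1 - (j : ℕ)) = j := by omega
  have e2 : n - 1 - (j : ℕ) = n - (j + 1) := by omega
  have e3 : n - ((j : ℕ) + 1) + 1 = n - j := by omega
  have e4 : (i : ℕ) + 1 + j - 1 = i + j := by omega
  rw [gridNodeWeight, e1, e2, e3]
  simp [triOfEdges, SquareOrientation.west, SquareOrientation.north, SquareOrientation.east,
    SquareOrientation.south, TriOrientation.northwest, TriOrientation.southeast, nwEdge, seEdge,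
    ← add_assoc, e4]

open Classical in
/-- A matrix element of the grid of triple crossings is a sum over the orientations. -/
theorem elt_grid3_eq_sum (w : Bool → Bool → Bool → Bool → Bool → Bool → ℝ) (n t : ℕ) :
    elt n t (grid3 w n) = ∑ σ : TriOrientation n with σ.BoundaryState t,
      ∏ i : Fin n, ∏ j : Fin n, w (σ.west i j) (σ.northwest i j) (σ.north i j)
        (σ.east i j) (σ.southeast i j) (σ.south i j) := by
  rw [elt_grid3]
  have e : ∀ A, ind (finalState n t) (fun l => gridBit n t A l (gridClock n n 0 l)) =
      if ∀ l, gridBit n t A l (gridClock n n 0 l) = finalState n t l then 1 else 0 := by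
    intro A
    rw [ind]
    simp only [funext_iff]
  simp only [e, mul_ite, mul_one, mul_zero]
  rw [← Finset.sum_filter]
  refine Finset.sum_bij' (fun A _ => triOfEdges n t A) (fun σ _ => edgesOfTri σ) ?_ ?_ ?_ ?_ ?_
  · intro A hA
    rw [Finset.mem_filter] at hA ⊢
    exact ⟨Finset.mem_univ _, boundaryState_triOfEdges hA.2⟩
  · intro σ hσ
    rw [Finset.mem_filter] at hσ ⊢
    exact ⟨Finset.mem_powerset.2 (Finset.filter_subset _ _), gridBit_final_edgesOfTri hσ.2⟩
  · intro A hA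
    rw [Finset.mem_filter, Finset.mem_powerset] at hA
    exact edgesOfTri_triOfEdges hA.1
  · intro σ hσ
    rw [Finset.mem_filter] at hσ
    exact triOfEdges_edgesOfTri hσ.2
  · intro A _
    exact prod_gridNodeWeight w n t A

/-! ### The full grid is the 20V model, the empty grid the 6V model -/

theorem segProd_smul (c : ℝ) (f : ℕ → LineOp) (a l : ℕ) :
    segProd (fun i => c • f i) a l = c ^ l • segProd f a l := by
  induction l with
  | zero => simp
  | succ l ih => rw [segProd_succ, segProd_succ, ih, smul_mul_smul_comm, pow_succ]

theorem topRows_full (n : ℕ) :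
    topRows n 0 (2 * n - 1) n = (2 : ℝ) ^ n ^ 2 • grid3 wM n := by
  have e : topRows n 0 (2 * n - 1) n =
      segProd (fun s => (2 : ℝ) ^ n • row3 wM n (n - 1 - s)) 0 n := by
    refine segProd_congr fun s _ hs => ?_
    rw [row3, ← segProd_smul]
    refine segProd_congr fun i _ hi => ?_
    rw [node_of_mem (Nat.zero_le _) (by omega) rfl, crossHD, crossHV, crossDV,
      op3_wM_eq_down] <;> simp
  rw [e, segProd_smul, ← pow_mul, ← sq, grid3]

/-- The 6V weights on the horizontal and vertical lines, with free diagonal lines. -/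
noncomputable def wFree : Bool → Bool → Bool → Bool → Bool → Bool → ℝ := fun p q r p' q' r' =>
  if q = q' then sixVertexWeight 1 √2 1 p r p' r' else 0

theorem wB_eq_sixVertexWeight (p r p' r' : Bool) :
    wB p r p' r' = sixVertexWeight 1 √2 1 p r p' r' := by
  cases p <;> cases r <;> cases p' <;> cases r' <;> simp [wB, sixVertexWeight]

/-- Adding a free diagonal to each 6V node gives both models the same form, so that
`elt_grid3_eq_sum` serves for both. -/
theorem op3_wFree {a b c : Line} (hab : a ≠ b) : op3 wFree a b c = op2 wB a c := by
  ext F σ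
  rw [op3_apply, op2_apply]
  refine Finset.sum_congr rfl fun x _ => ?_
  rw [Finset.sum_eq_single (σ b)]
  · refine Finset.sum_congr rfl fun z _ => ?_
    rw [update_comm hab, update_eq_self, wFree, if_pos rfl, wB_eq_sixVertexWeight]
  · intro y _ hy
    refine Finset.sum_eq_zero fun z _ => ?_
    rw [wFree, if_neg hy.symm, zero_mul]
  · simp

theorem topRows_empty (n : ℕ) : topRows n 0 0 n = grid3 wFree n :=
  segProd_congr fun s _ _ => segProd_congr fun i _ _ => by
    rw [node_of_le (Nat.zero_le _), crossHV, op3_wFree (by simp)]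

-- Conservation of the number of covered lines at a node is the triangular ice rule, so the product
-- of weights is an indicator.
open Classical in
theorem sum_wM_eq_card (n t : ℕ) :
    (∑ σ : TriOrientation n with σ.BoundaryState t,
      ∏ i : Fin n, ∏ j : Fin n, wM (σ.west i j) (σ.northwest i j) (σ.north i j)
        (σ.east i j) (σ.southeast i j) (σ.south i j)) =
    Fintype.card {σ : TriOrientation n // σ.IceRule ∧ σ.BoundaryState t} := by
  rw [Fintype.card_subtype, Finset.card_eq_sum_ones, Nat.cast_sum, Finset.sum_filter,
    Finset.sum_filter]
  refine Finset.sum_congr rfl fun σ _ => ?_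
  have hw : ∀ i j, wM (σ.west i j) (σ.northwest i j) (σ.north i j)
      (σ.east i j) (σ.southeast i j) (σ.south i j) =
      if σ.toSquareOrientation.incoming i j
        + (σ.northwest i j).toNat + (!σ.southeast i j).toNat = 3 ∧
      σ.toSquareOrientation.outgoing i j
        + (!σ.northwest i j).toNat + (σ.southeast i j).toNat = 3 then 1 else 0 := by
    intro i j
    unfold SquareOrientation.incoming SquareOrientation.outgoing
    generalize σ.west i j = b1
    generalize σ.northwest i j = b2
    generalize σ.north i j = b3
    generalize σ.east i j = b4
    generalize σ.southeast i j = b5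
    generalize σ.south i j = b6
    revert b1 b2 b3 b4 b5 b6
    simp [wM]
  have hprod : (∏ i : Fin n, ∏ j : Fin n, wM (σ.west i j) (σ.northwest i j) (σ.north i j)
      (σ.east i j) (σ.southeast i j) (σ.south i j)) = if σ.IceRule then 1 else 0 := by
    simp only [hw]
    by_cases H : σ.IceRule
    · rw [if_pos H]
      exact Finset.prod_eq_one fun i _ => Finset.prod_eq_one fun j _ => if_pos (H i j)
    · rw [if_neg H]
      simp only [TriOrientation.IceRule, not_forall] at H
      obtain ⟨i, j, H⟩ := H
      exact Finset.prod_eq_zero (Finset.mem_univ i)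
        (Finset.prod_eq_zero (Finset.mem_univ j) (if_neg H))
  rw [hprod]
  by_cases h1 : σ.IceRule <;> by_cases h2 : σ.BoundaryState t <;> simp [h1, h2]

/-- An orientation of the square grid extended by straight diagonal lines. -/
def SquareOrientation.withDiag {n : ℕ} (t : ℕ) (σ : SquareOrientation n) : TriOrientation n where
  toSquareOrientation := σ
  diag e := decide ((e.1.1 : ℕ) + e.1.2 - 1 < t)

theorem TriOrientation.BoundaryState.eq_withDiag {n t : ℕ} {σ : TriOrientation n}
    (hσ : σ.BoundaryState t) (hd : ∀ i j, σ.northwest i j = σ.southeast i j) :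
    σ.toSquareOrientation.withDiag t = σ := by
  -- Induction on the abscissa carries the state along each diagonal from its Northwest end.
  have key : ∀ (m : ℕ) (e : DiagEdge n), (e.1.1 : ℕ) = m →
      σ.diag e = decide ((e.1.1 : ℕ) + e.1.2 - 1 < t) := by
    intro m
    induction m with
    | zero => exact fun e he => hσ.2 e (Or.inl (Fin.ext he))
    | succ m ih =>
      rintro ⟨⟨x, y⟩, hne⟩ he
      simp only at he
      by_cases hy : y = Fin.last n
      · exact hσ.2 _ (by simp [hy])
      · have hy' : (y : ℕ) < n := by
          have : (y : ℕ) ≠ n := fun e => hy (Fin.ext e)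
          omega
        have hse : (⟨(x, y), hne⟩ : DiagEdge n) = seEdge ⟨m, by omega⟩ ⟨y, hy'⟩ := by
          simp only [seEdge, Subtype.mk.injEq, Prod.mk.injEq, Fin.ext_iff]
          simp [he]
        have hnw := ih (nwEdge ⟨m, by omega⟩ ⟨y, hy'⟩) rfl
        have := hd ⟨m, by omega⟩ ⟨y, hy'⟩
        rw [TriOrientation.northwest, TriOrientation.southeast, hnw] at this
        have e' : m + 1 + (y : ℕ) - 1 = m + (y + 1) - 1 := by omega
        rw [hse, ← this]
        exact decide_eq_decide.2 (by simp [seEdge, nwEdge, e'])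
  exact TriOrientation.ext rfl rfl (funext fun e => (key _ e rfl).symm)

theorem Z6V_eq_sum (n : ℕ) :
    Z6V n (1 : ℝ) √2 1 = ∑ σ : SquareOrientation n with σ.DWBC, ∏ i : Fin n, ∏ j : Fin n,
      sixVertexWeight 1 √2 1 (σ.west i j) (σ.north i j) (σ.east i j) (σ.south i j) := by
  rw [Z6V]
  refine Finset.sum_subset (Finset.monotone_filter_right _ fun _ _ H => H.2) ?_
  intro σ _ H
  have H' : ¬ σ.IceRule := by simp_all
  simp only [SquareOrientation.IceRule, not_forall] at H'
  obtain ⟨i, j, H'⟩ := H'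
  refine Finset.prod_eq_zero (Finset.mem_univ i) (Finset.prod_eq_zero (Finset.mem_univ j) ?_)
  revert H'
  unfold SquareOrientation.incoming SquareOrientation.outgoing
  generalize σ.west i j = b1
  generalize σ.north i j = b2
  generalize σ.east i j = b3
  generalize σ.south i j = b4
  revert b1 b2 b3 b4
  simp [sixVertexWeight]

-- A nonzero weight forces every diagonal to keep its state, which the boundary prescribes; one
-- extension of each square orientation remains.
open Classical in
theorem sum_wFree_eq_Z6V (n t : ℕ) :
    (∑ σ : TriOrientation n with σ.BoundaryState t,
      ∏ i : Fin n, ∏ j : Fin n, wFree (σ.west i j) (σ.northwest i j) (σ.north i j)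
        (σ.east i j) (σ.southeast i j) (σ.south i j)) = Z6V n (1 : ℝ) √2 1 := by
  rw [Z6V_eq_sum]
  have hsub : ∑ σ : TriOrientation n with σ.BoundaryState t ∧
        ∀ i j, σ.northwest i j = σ.southeast i j,
      ∏ i : Fin n, ∏ j : Fin n, wFree (σ.west i j) (σ.northwest i j) (σ.north i j)
        (σ.east i j) (σ.southeast i j) (σ.south i j) =
      ∑ σ : TriOrientation n with σ.BoundaryState t,
      ∏ i : Fin n, ∏ j : Fin n, wFree (σ.west i j) (σ.northwest i j) (σ.north i j)
        (σ.east i j) (σ.southeast i j) (σ.south i j) := by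
    refine Finset.sum_subset (Finset.monotone_filter_right _ fun _ _ H => H.1) ?_
    intro σ _ H
    have H' : ¬ ∀ i j, σ.northwest i j = σ.southeast i j := by simp_all
    simp only [not_forall] at H'
    obtain ⟨i, j, H'⟩ := H'
    exact Finset.prod_eq_zero (Finset.mem_univ i)
      (Finset.prod_eq_zero (Finset.mem_univ j) (if_neg H'))
  rw [← hsub]
  refine Finset.sum_bij' (fun σ _ => σ.toSquareOrientation) (fun σ _ => σ.withDiag t)
    ?_ ?_ ?_ ?_ ?_
  · intro σ hσ
    rw [Finset.mem_filter] at hσ ⊢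
    exact ⟨Finset.mem_univ _, hσ.2.1.1⟩
  · intro σ hσ
    rw [Finset.mem_filter] at hσ ⊢
    refine ⟨Finset.mem_univ _, ⟨hσ.2, fun e _ => rfl⟩, fun i j => ?_⟩
    simp only [TriOrientation.northwest, TriOrientation.southeast, SquareOrientation.withDiag,
      nwEdge, seEdge, decide_eq_decide, Fin.val_castSucc, Fin.val_succ]
    omega
  · intro σ hσ
    rw [Finset.mem_filter] at hσ
    exact hσ.2.1.eq_withDiag hσ.2.2
  · intro σ _
    rfl
  · intro σ hσ
    rw [Finset.mem_filter] at hσ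
    exact Finset.prod_congr rfl fun i _ => Finset.prod_congr rfl fun j _ =>
      if_pos (hσ.2.2 i j)

open Classical in
theorem card_boundaryState {n t : ℕ} (hn : 1 ≤ n) (ht : t ≤ n) (ht' : n ≤ t + 1) :
    (Fintype.card {σ : TriOrientation n // σ.IceRule ∧ σ.BoundaryState t} : ℝ) =
      Z6V n (1 : ℝ) √2 1 := by
  have key := elt_topRows_eq ht ht' hn
  rw [topRows_full, topRows_empty, elt, LinearMap.smul_apply, Pi.smul_apply, smul_eq_mul] at key
  have key' := mul_left_cancel₀ (by positivity) key
  rw [← sum_wM_eq_card, ← elt_grid3_eq_sum, ← sum_wFree_eq_Z6V n t, ← elt_grid3_eq_sum]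
  exact key'

/-! ### The two domain wall boundary conditions -/

/-- Both corner edges lie on the diagonal `n - 1`. The other West and South edges lie on smaller
diagonals, the other North and East edges on larger ones. Thus `t = n` covers the corners, and `t =
n - 1` in `DWBC2_iff` does not. -/
theorem DWBC1_iff {n : ℕ} (hn : 1 ≤ n) (σ : TriOrientation n) :
    σ.DWBC1 ↔ σ.BoundaryState n := by
  unfold TriOrientation.DWBC1 TriOrientation.BoundaryRule TriOrientation.CornerRule
    TriOrientation.BoundaryState
  rw [and_assoc, ← forall_and]
  refine and_congr_right fun _ => forall_congr' ?_
  rintro ⟨⟨x, y⟩, hne⟩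
  simp only [ne_eq, Prod.mk.injEq, Fin.ext_iff, Fin.val_zero, Fin.val_last] at hne ⊢
  cases σ.diag ⟨(x, y), _⟩ <;> simp only [Bool.false_eq_true, Bool.true_eq_false,
    imp_false, imp_true_iff, true_and, and_true, false_eq_decide_iff, true_eq_decide_iff] <;> omega

theorem DWBC2_iff {n : ℕ} (hn : 1 ≤ n) (σ : TriOrientation n) :
    σ.DWBC2 ↔ σ.BoundaryState (n - 1) := by
  unfold TriOrientation.DWBC2 TriOrientation.BoundaryRule TriOrientation.CornerRule
    TriOrientation.BoundaryState
  rw [and_assoc, ← forall_and]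
  refine and_congr_right fun _ => forall_congr' ?_
  rintro ⟨⟨x, y⟩, hne⟩
  simp only [ne_eq, Prod.mk.injEq, Fin.ext_iff, Fin.val_zero, Fin.val_last] at hne ⊢
  cases σ.diag ⟨(x, y), _⟩ <;> simp only [Bool.false_eq_true, Bool.true_eq_false,
    imp_false, imp_true_iff, true_and, and_true, false_eq_decide_iff, true_eq_decide_iff] <;> omega

end IceModel

theorem mainTheorem3 (n : ℕ) (hn : 1 ≤ n) :
    (IceModel.count20V1 n : ℝ) = IceModel.Z6V n (1 : ℝ) (Real.sqrt 2) 1 ∧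
      (IceModel.count20V2 n : ℝ) = IceModel.Z6V n (1 : ℝ) (Real.sqrt 2) 1 := by
  classical
  refine ⟨?_, ?_⟩
  · rw [← IceModel.card_boundaryState hn le_rfl (Nat.le_succ n), IceModel.count20V1]
    congr 1
    exact Fintype.card_congr (Equiv.subtypeEquivRight fun σ =>
      and_congr_right fun _ => IceModel.DWBC1_iff hn σ)
  · rw [← IceModel.card_boundaryState hn (Nat.sub_le n 1) (by omega), IceModel.count20V2]
    congr 1
    exact Fintype.card_congr (Equiv.subtypeEquivRight fun σ =>
      and_congr_right fun _ => IceModel.DWBC2_iff hn σ)
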